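/- Let $G$ be a profinite group (a compact, totally disconnected topological group), and let $G'$ denote its commutator subgroup, i.e. the closed subgroup of $G$ generated by all commutators $[x,y]=x^{-1}y^{-1}xy$ with $x,y\in G$. Let $Z_m(G')$ denote the $m$th term of the upper central series of $G'$. The following conditions are equivalent. 1. The set of all commutators in $G$ is covered by countably many nilpotent subgroups; that is, there are nilpotent subgroups $G_1,G_2,\dots$ of $G$ such that every commutator $[x,y]$ with $x,y\in G$ lies in $\bigcup_i G_i$. (This is the same whether the $G_i$ are arbitrary abstract subgroups or are required to be closed in $G$: both versions are equivalent to each other and to the conditions below.) 2. $G'$ is finite-by-nilpotent; that is, $G'$ has a finite normal subgroup $N$ such that $G'/N$ is nilpotent. 3. There exists a positive integer $m$ such that $Z_m(G')$ is open in $G'$. -/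

import Mathlib

/-- The commutator subgroup `G'` of a topological group `G`: the closed subgroup generated by all
commutators. -/
abbrev closedDerived (G : Type*) [Group G] [TopologicalSpace G] [IsTopologicalGroup G] :
    Subgroup G :=
  (Subgroup.closure (commutatorSet G)).topologicalClosure

/-- A group is finite-by-nilpotent if it has a finite normal subgroup with nilpotent quotient. -/
def IsFiniteByNilpotent (K : Type*) [Group K] : Prop :=
  ∃ (N : Subgroup K) (_ : N.Normal), Finite N ∧ Group.IsNilpotent (K ⧸ N)

/-! The core is the passage from a nilpotent cover to an open term of the upper central series.
Closures of nilpotent subgroups are nilpotent, so the cover may be taken closed. Baire's theorem on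
`G × G` then gives, near any pair of cosets of an open normal subgroup, a box `Ua × Ub` whose
commutators all lie in one nilpotent subgroup; finiteness of the index makes `U` uniform
(`exists_openNormalSubgroup_uniform`). Those commutators generate a nilpotent subgroup normalized by
`U` that contains `[U,U]` (`exists_isNilpotent_le_normalizer`).

Three rounds give open normal subgroups `V ≤ U ≤ T` with `R = [T,T]` nilpotent. Intersecting `V`
with the lower central series of `R` cuts it into abelian sections on which `T` acts through an
abelian group. It remains to see that the derived subgroup acts unipotently on each section. The
subgroup `[U,G]` does, because its action is controlled by finitely many commuting nilpotent pieces
(`isNilpotent_augSpan_commutator_top`). Modulo the ideal this generates, `U` acts centrally, so the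
image of `G` is central-by-finite with unipotent commutators
(`isNilpotent_augSpan_commutator_of_central`). There the derived group is finite by Schur; its
elements differ from 1 by additive torsion, and modulo each prime `p` it is a `p`-group by Burnside
transfer, hence unipotent.

Conversely, an open `Z_m(G')` has finitely many cosets, and each lies in a nilpotent subgroup
`⟨k⟩Z_m(G')`. Open terms and finite-by-nilpotency are linked by Baer's theorem and, the other way,
by an open normal subgroup meeting the finite one trivially. -/

open scoped commutatorElement

/-! ### Groups whose commutators have `p`-power order. -/

section CommutatorsOfPrimePowerOrder

variable {A : Type*} [Group A]

theorem eq_one_of_pow_prime_pow_eq_one {p q : ℕ} (hp : p.Prime) (hq : q.Prime) (hpq : q ≠ p)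
    {g : A} {k l : ℕ} (hk : g ^ p ^ k = 1) (hl : g ^ q ^ l = 1) : g = 1 := by
  have h : (p ^ k).Coprime (q ^ l) := Nat.Coprime.pow _ _ ((Nat.coprime_primes hp hq).2 hpq.symm)
  have := Nat.dvd_gcd (orderOf_dvd_of_pow_eq_one hk) (orderOf_dvd_of_pow_eq_one hl)
  rw [h.gcd_eq_one] at this
  exact orderOf_eq_one_iff.1 (Nat.dvd_one.1 this)

/-- If all commutators of a finite group are `p`-elements, then the derived subgroup is a
`p`-group. -/
theorem isPGroup_commutator_of_finite [Finite A] {p : ℕ} (hp : p.Prime)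
    (h : ∀ a b : A, ∃ k : ℕ, ⁅a, b⁆ ^ p ^ k = 1) : IsPGroup p (commutator A) := by
  have := Fact.mk hp
  rw [IsPGroup.iff_card]
  refine ⟨_, Nat.eq_prime_pow_of_unique_prime_dvd Nat.card_pos.ne' ?_⟩
  intro q hq hdvd
  by_contra hqp
  have := Fact.mk hq
  obtain ⟨P⟩ : Nonempty (Sylow q A) := inferInstance
  -- For `n` normalizing `P` and `x ∈ P`, the commutator is both a `q`-element and a `p`-element,
  -- hence trivial. This is the hypothesis of Burnside's transfer theorem.
  have hP : Subgroup.normalizer P ≤ Subgroup.centralizer (P : Set A) := by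
    intro n hn x hx
    have hmem : ⁅n, x⁆ ∈ P := by
      rw [commutatorElement_def]
      exact mul_mem ((Subgroup.mem_normalizer_iff.1 hn x).1 hx) (inv_mem hx)
    obtain ⟨l, hl⟩ := P.isPGroup' ⟨_, hmem⟩
    obtain ⟨k, hk⟩ := h n x
    have := eq_one_of_pow_prime_pow_eq_one hp hq hqp hk (by simpa [Subtype.ext_iff] using hl)
    exact (commutatorElement_eq_one_iff_mul_comm.1 this).symm
  -- The target `P` of the transfer is abelian, and the kernel has order prime to `q`.
  have hle : commutator A ≤ (MonoidHom.transferSylow P hP).ker := by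
    rw [commutator_def, Subgroup.commutator_le]
    intro a _ b _
    rw [MonoidHom.mem_ker, map_commutatorElement, commutatorElement_eq_one_iff_mul_comm]
    exact Subtype.ext (hP (Subgroup.le_normalizer (Subtype.prop _)) _ (Subtype.prop _))
  exact MonoidHom.not_dvd_card_ker_transferSylow P hP
    (hdvd.trans (Subgroup.card_dvd_of_le hle))

/-- A group with centre of finite index has finitely many commutators. -/
theorem finite_commutatorSet_of_finiteIndex_center [(Subgroup.center A).FiniteIndex] :
    Finite (commutatorSet A) := by
  let f : (A ⧸ Subgroup.center A) × (A ⧸ Subgroup.center A) → A := fun x => ⁅x.1.out, x.2.out⁆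
  refine Set.Finite.subset (Set.finite_range f) ?_
  rintro _ ⟨a, b, rfl⟩
  refine ⟨(a, b), ?_⟩
  obtain ⟨⟨z, hz⟩, hz'⟩ := QuotientGroup.mk_out_eq_mul (Subgroup.center A) a
  obtain ⟨⟨w, hw⟩, hw'⟩ := QuotientGroup.mk_out_eq_mul (Subgroup.center A) b
  simp only [f, hz', hw', commutatorElement_def, mul_inv_rev]
  rw [Subgroup.mem_center_iff] at hz hw
  have e1 : a * z * (b * w) * (z⁻¹ * a⁻¹) = a * (b * w) * a⁻¹ := by
    rw [mul_assoc a z, ← hz (b * w)]; group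
  have e2 : a * (b * w) * a⁻¹ * (w⁻¹ * b⁻¹) = a * b * (w * a⁻¹) * w⁻¹ * b⁻¹ := by group
  rw [e1, e2, ← hw]; group

/-- The finite case applies modulo the centre. The derived subgroup is then a central extension of a
nilpotent group, hence nilpotent, and its unique Sylow `p`-subgroup contains every commutator. -/
theorem isPGroup_commutator_of_finiteIndex_center [(Subgroup.center A).FiniteIndex] {p : ℕ}
    (hp : p.Prime) (h : ∀ a b : A, ∃ k : ℕ, ⁅a, b⁆ ^ p ^ k = 1) :
    IsPGroup p (commutator A) := by
  have := Fact.mk hp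
  have := finite_commutatorSet_of_finiteIndex_center (A := A)
  have hQ : IsPGroup p (commutator (A ⧸ Subgroup.center A)) := by
    refine isPGroup_commutator_of_finite hp fun a b => ?_
    obtain ⟨a, rfl⟩ := QuotientGroup.mk_surjective a
    obtain ⟨b, rfl⟩ := QuotientGroup.mk_surjective b
    obtain ⟨k, hk⟩ := h a b
    refine ⟨k, ?_⟩
    have := congrArg (QuotientGroup.mk' (Subgroup.center A)) hk
    rwa [map_pow, map_commutatorElement, map_one] at this
  have : Group.IsNilpotent (commutator (A ⧸ Subgroup.center A)) := hQ.isNilpotent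
  let f : commutator A →* commutator (A ⧸ Subgroup.center A) :=
    ((QuotientGroup.mk' (Subgroup.center A)).comp (commutator A).subtype).codRestrict _ (by
      rintro ⟨x, hx⟩
      have := Subgroup.mem_map_of_mem (QuotientGroup.mk' (Subgroup.center A)) hx
      rw [commutator_def, Subgroup.map_commutator] at this
      exact Subgroup.commutator_mono le_top le_top this)
  have hnil : Group.IsNilpotent (commutator A) := by
    refine Subgroup.isNilpotent_of_ker_le_center f ?_
    rintro ⟨x, hx⟩ hfx
    have hxc : x ∈ Subgroup.center A := by
      have := congrArg Subtype.val (MonoidHom.mem_ker.1 hfx)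
      simpa [f] using this
    rw [Subgroup.mem_center_iff] at hxc ⊢
    rintro ⟨y, hy⟩
    exact Subtype.ext (hxc y)
  obtain ⟨P⟩ : Nonempty (Sylow p (commutator A)) := inferInstance
  have hPn : (P : Subgroup (commutator A)).Normal := inferInstance
  have hle : commutator A ≤ (P : Subgroup (commutator A)).map (commutator A).subtype := by
    conv_lhs => rw [commutator_def]
    rw [Subgroup.commutator_le]
    intro a _ b _
    obtain ⟨k, hk⟩ := h a b
    let c : commutator A := ⟨⁅a, b⁆, Subgroup.commutator_mem_commutator (Subgroup.mem_top _) (Subgroup.mem_top _)⟩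
    have hc : c ^ p ^ k = 1 := Subtype.ext hk
    have hcp : IsPGroup p (Subgroup.zpowers c) := by
      rintro ⟨_, n, rfl⟩
      refine ⟨k, Subtype.ext ?_⟩
      change (c ^ n) ^ p ^ k = 1
      rw [← zpow_natCast, ← zpow_mul, mul_comm, zpow_mul, zpow_natCast, hc, one_zpow]
    obtain ⟨Q, hQ⟩ := hcp.exists_le_sylow
    have : Q = P := by
      have := Sylow.unique_of_normal P hPn
      exact Subsingleton.elim _ _
    exact ⟨c, this ▸ hQ (Subgroup.mem_zpowers c), rfl⟩
  rintro ⟨x, hx⟩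
  obtain ⟨y, hy, rfl⟩ := hle hx
  obtain ⟨k, hk⟩ := P.isPGroup' ⟨y, hy⟩
  refine ⟨k, ?_⟩
  simpa [Subtype.ext_iff] using hk

end CommutatorsOfPrimePowerOrder

/-! ### Unipotent actions expressed by nilpotent spans. -/

section AugmentationSpan

variable {G S S' : Type*} [Group G] [Ring S] [Ring S'] (ρ : G →* S)

/-- The additive span of the elements `ρ d - 1` with `d` in a subgroup `D`. It is nilpotent exactly
when `D` acts unipotently through `ρ`. -/
def augSpan (D : Subgroup G) : Submodule ℤ S :=
  Submodule.span ℤ ((fun d => ρ d - 1) '' (D : Set G))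

theorem sub_one_mem_augSpan {D : Subgroup G} {d : G} (hd : d ∈ D) : ρ d - 1 ∈ augSpan ρ D :=
  Submodule.subset_span ⟨d, hd, rfl⟩

theorem augSpan_le {D : Subgroup G} {P : Submodule ℤ S} :
    augSpan ρ D ≤ P ↔ ∀ d ∈ D, ρ d - 1 ∈ P := by
  simp [augSpan, Submodule.span_le, Set.subset_def]

theorem IsNilpotent.of_le {P Q : Submodule ℤ S} (hQ : IsNilpotent Q) (h : P ≤ Q) :
    IsNilpotent P := by
  obtain ⟨n, hn⟩ := hQ
  refine ⟨n, ?_⟩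
  rw [Submodule.zero_eq_bot] at *
  exact le_bot_iff.1 (hn ▸ pow_le_pow_left' h n)

theorem map_augSpan (f : S →+* S') (D : Subgroup G) :
    (augSpan ρ D).map f.toIntAlgHom.toLinearMap = augSpan ((f : S →* S').comp ρ) D := by
  rw [augSpan, augSpan, Submodule.map_span, Set.image_image]
  simp

theorem augSpan_comp {H : Type*} [Group H] (φ : H →* G) (D : Subgroup H) :
    augSpan (ρ.comp φ) D = augSpan ρ (D.map φ) := by
  rw [augSpan, augSpan, Subgroup.coe_map, Set.image_image]
  rfl

theorem IsNilpotent.map_submodule {P : Submodule ℤ S} (hP : IsNilpotent P) (f : S →+* S') :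
    IsNilpotent (P.map f.toIntAlgHom.toLinearMap) := by
  obtain ⟨n, hn⟩ := hP
  refine ⟨n, ?_⟩
  rw [← Submodule.map_pow, hn, Submodule.zero_eq_bot, Submodule.zero_eq_bot, Submodule.map_bot]

/-- By normality `ρ g` slides past `ρ d - 1`, replacing `d` by a conjugate. Hence the left ideal is
two-sided and its powers can be computed factor by factor. -/
theorem commute_top_augSpan (hρ : Submodule.span ℤ (Set.range ρ) = ⊤) (N : Subgroup G)
    [hN : N.Normal] : Commute (⊤ : Submodule ℤ S) (augSpan ρ N) := by
  rw [← hρ]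
  refine le_antisymm ?_ ?_
  · rw [augSpan, Submodule.span_mul_span, Submodule.span_le]
    rintro _ ⟨_, ⟨g, rfl⟩, _, ⟨d, hd, rfl⟩, rfl⟩
    have : ρ g * (ρ d - 1) = (ρ (g * d * g⁻¹) - 1) * ρ g := by
      rw [sub_mul, ← map_mul, mul_sub, ← map_mul]; simp
    simp only [this]
    exact Submodule.mul_mem_mul (sub_one_mem_augSpan ρ (hN.conj_mem d hd g))
      (Submodule.subset_span ⟨g, rfl⟩)
  · rw [augSpan, Submodule.span_mul_span, Submodule.span_le]
    rintro _ ⟨_, ⟨d, hd, rfl⟩, _, ⟨g, rfl⟩, rfl⟩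
    have : (ρ d - 1) * ρ g = ρ g * (ρ (g⁻¹ * d * g) - 1) := by
      rw [sub_mul, ← map_mul, mul_sub, ← map_mul]; simp [mul_assoc]
    simp only [this]
    refine Submodule.mul_mem_mul (Submodule.subset_span ⟨g, rfl⟩) (sub_one_mem_augSpan ρ ?_)
    simpa using hN.conj_mem d hd g⁻¹

/-- The left ideal generated by the elements `ρ d - 1` with `d ∈ D`. -/
def augIdeal (D : Subgroup G) : Ideal S where
  __ := ((⊤ : Submodule ℤ S) * augSpan ρ D).toAddSubmonoid
  smul_mem' s x hx := by
    have h : s * x ∈ (⊤ : Submodule ℤ S) * (⊤ * augSpan ρ D) :=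
      Submodule.mul_mem_mul Submodule.mem_top hx
    rw [← mul_assoc] at h
    exact (mul_le_mul_left le_top _ : (⊤ * ⊤ : Submodule ℤ S) * _ ≤ _) h

theorem mem_augIdeal {D : Subgroup G} {x : S} :
    x ∈ augIdeal ρ D ↔ x ∈ (⊤ : Submodule ℤ S) * augSpan ρ D := Iff.rfl

theorem sub_one_mem_augIdeal {D : Subgroup G} {d : G} (hd : d ∈ D) : ρ d - 1 ∈ augIdeal ρ D := by
  rw [mem_augIdeal, ← one_mul (ρ d - 1)]
  exact Submodule.mul_mem_mul Submodule.mem_top (sub_one_mem_augSpan ρ hd)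

theorem augIdeal_isTwoSided (hρ : Submodule.span ℤ (Set.range ρ) = ⊤) (N : Subgroup G)
    [N.Normal] : (augIdeal ρ N).IsTwoSided := by
  refine ⟨fun {a} b ha => ?_⟩
  rw [mem_augIdeal] at *
  have h := Submodule.mul_mem_mul ha (Submodule.mem_top (x := b))
  rw [mul_assoc, ← (commute_top_augSpan ρ hρ N).eq, ← mul_assoc] at h
  exact (mul_le_mul_left le_top _ : (⊤ * ⊤ : Submodule ℤ S) * _ ≤ _) h

theorem span_range_comp_eq_top (hρ : Submodule.span ℤ (Set.range ρ) = ⊤) (f : S →+* S')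
    (hf : Function.Surjective f) :
    Submodule.span ℤ (Set.range ((f : S →* S').comp ρ)) = ⊤ := by
  have := congrArg (Submodule.map f.toIntAlgHom.toLinearMap) hρ
  rw [Submodule.map_span, Submodule.map_top, LinearMap.range_eq_top.2 hf, ← Set.range_comp] at this
  exact this

/-- Unipotency of `D` can be checked modulo the ideal of a unipotent normal subgroup. -/
theorem isNilpotent_augSpan_of_quotient (hρ : Submodule.span ℤ (Set.range ρ) = ⊤)
    (N D : Subgroup G) [N.Normal] [(augIdeal ρ N).IsTwoSided] (hN : IsNilpotent (augSpan ρ N))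
    (hD : IsNilpotent
      (augSpan ((Ideal.Quotient.mk (augIdeal ρ N) : S →* S ⧸ augIdeal ρ N).comp ρ) D)) :
    IsNilpotent (augSpan ρ D) := by
  obtain ⟨k, hk⟩ := hD
  obtain ⟨m, hm⟩ := hN
  rw [← map_augSpan, ← Submodule.map_pow, Submodule.zero_eq_bot] at hk
  have hle : augSpan ρ D ^ k ≤ ⊤ * augSpan ρ N := by
    intro x hx
    have := hk ▸ Submodule.mem_map_of_mem (f := (Ideal.Quotient.mk
      (augIdeal ρ N)).toIntAlgHom.toLinearMap) hx
    exact (mem_augIdeal ρ).1 (Ideal.Quotient.eq_zero_iff_mem.1 ((Submodule.mem_bot ℤ).1 this))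
  refine ⟨k * m, ?_⟩
  rw [pow_mul]
  have h := pow_le_pow_left' hle m
  rw [(commute_top_augSpan ρ hρ N).mul_pow, hm, mul_zero, Submodule.zero_eq_bot] at h
  exact le_bot_iff.1 h

/-- A finite `p`-group acts unipotently in characteristic `p`: the case of the regular
representation. -/
theorem isNilpotent_augSpan_monoidAlgebra {p : ℕ} (hp : p.Prime) {P : Type*} [Group P] [Finite P]
    (hP : IsPGroup p P) : IsNilpotent (augSpan (MonoidAlgebra.of (ZMod p) P) ⊤) := by
  have := Fact.mk hp
  let V := MonoidAlgebra (ZMod p) P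
  let e : Multiplicative V ≃ (P → ZMod p) := Multiplicative.toAdd.trans
    (MonoidAlgebra.coeffEquiv.trans Finsupp.equivFunOnFinite)
  have : Finite (Multiplicative V) := Finite.of_equiv _ e.symm
  let φ : P →* MulAut (Multiplicative V) := ((MulAutMultiplicative V).symm : _ →* _).comp
    ((AddAut.mulLeft (R := V)).comp (Units.map (MonoidAlgebra.of (ZMod p) P) |>.comp
      (toUnits (G := P) : P →* Pˣ)))
  have hφ : ∀ (g : P) (v : V), φ g (Multiplicative.ofAdd v)
      = Multiplicative.ofAdd (MonoidAlgebra.of (ZMod p) P g * v) := fun g v => rfl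
  -- The semidirect product of the group algebra with `P` is a finite `p`-group, hence nilpotent. In
  -- it `[g, v] = (g - 1)v`, so its lower central series bounds the powers of the augmentation span.
  have hW : IsPGroup p (Multiplicative V ⋊[φ] P) := by
    obtain ⟨a, ha⟩ := IsPGroup.iff_card.1 hP
    have hV : Nat.card (Multiplicative V) = p ^ Nat.card P := by
      rw [Nat.card_congr e, Nat.card_fun, Nat.card_zmod]
    exact IsPGroup.of_card (n := Nat.card P + a) (by
      rw [SemidirectProduct.card, hV, ha, pow_add])
  have : Finite (Multiplicative V ⋊[φ] P) :=
    Finite.of_equiv _ SemidirectProduct.equivProd.symm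
  obtain ⟨n, hn⟩ := Subgroup.nilpotent_iff_lowerCentralSeries.1 hW.isNilpotent
  let Q : ℕ → Submodule ℤ V := fun j => AddSubgroup.toIntSubmodule
    (Subgroup.toAddSubgroup' (((⊤ : Subgroup (Multiplicative V ⋊[φ] P)).lowerCentralSeries j).comap
      SemidirectProduct.inl))
  have hQ : ∀ j v, v ∈ Q j ↔ (SemidirectProduct.inl (Multiplicative.ofAdd v) : _ ⋊[φ] P) ∈
      (⊤ : Subgroup (Multiplicative V ⋊[φ] P)).lowerCentralSeries j := fun j v => Iff.rfl
  have key : ∀ j, augSpan (MonoidAlgebra.of (ZMod p) P) ⊤ ^ j ≤ Q j := by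
    intro j
    induction j with
    | zero => intro v _; rw [hQ]; exact Subgroup.mem_top _
    | succ j ih =>
      rw [pow_succ', augSpan]
      refine (mul_le_mul_right ih _).trans ?_
      rw [← Submodule.span_eq (Q j), Submodule.span_mul_span, Submodule.span_le]
      rintro _ ⟨_, ⟨g, -, rfl⟩, v, hv, rfl⟩
      refine (hQ _ _).2 ?_
      rw [Subgroup.lowerCentralSeries_succ, Subgroup.commutator_comm]
      have := Subgroup.commutator_mem_commutator
        (Subgroup.mem_top (SemidirectProduct.inr g : Multiplicative V ⋊[φ] P)) ((hQ j v).1 hv)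
      convert this using 1
      rw [commutatorElement_def, ← map_inv, ← SemidirectProduct.inl_aut, hφ, ← map_inv, ← map_mul]
      congr 1
      have : (MonoidAlgebra.of (ZMod p) P g - 1) * v = MonoidAlgebra.of (ZMod p) P g * v + -v := by
        rw [sub_mul, one_mul, sub_eq_add_neg]
      exact congrArg Multiplicative.ofAdd this
  refine ⟨n, ?_⟩
  rw [Submodule.zero_eq_bot, eq_bot_iff]
  intro v hv
  have := (hQ n v).1 (key n hv)
  rw [hn, Subgroup.mem_bot, ← map_one SemidirectProduct.inl] at this
  exact congrArg Multiplicative.toAdd (SemidirectProduct.inl_injective this)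

theorem isNilpotent_augSpan_of_isPGroup {p : ℕ} (hp : p.Prime) [CharP S p] {P : Type*} [Group P]
    [Finite P] (hP : IsPGroup p P) (σ : P →* S) : IsNilpotent (augSpan σ ⊤) := by
  let _ : Algebra (ZMod p) S := ZMod.algebra S p
  let f : MonoidAlgebra (ZMod p) P →+* S := (MonoidAlgebra.lift (ZMod p) S P σ).toRingHom
  have h := (isNilpotent_augSpan_monoidAlgebra hp hP).map_submodule f
  rw [map_augSpan] at h
  have : (f : MonoidAlgebra (ZMod p) P →* S).comp (MonoidAlgebra.of (ZMod p) P) = σ := by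
    ext g; simp [f]
  rwa [this] at h

end AugmentationSpan

/-! ### Unipotency for central-by-finite images. -/

section CentralByFinite

theorem exists_one_add_pow_eq {S : Type*} [Ring S] (x : S) (e : ℕ) :
    ∃ r : S, Commute x r ∧ (1 + x) ^ e = 1 + e * x + x ^ 2 * r := by
  induction e with
  | zero => exact ⟨0, Commute.zero_right _, by simp⟩
  | succ e ih =>
    obtain ⟨r, hr, h⟩ := ih
    have h1 : Commute x (e : S) := Nat.commute_cast x e
    refine ⟨e + r + r * x, (h1.add_right hr).add_right (hr.mul_right rfl), ?_⟩
    rw [pow_succ, h]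
    have h1' : (e : S) * x = x * e := h1.eq.symm
    have h2' : x * r = r * x := hr.eq
    push_cast
    have e1 : x ^ 2 * (e + r + r * x) = (e : S) * x * x + x ^ 2 * r + x ^ 2 * r * x := by
      rw [mul_add, mul_add, h1', mul_assoc x, h1']
      noncomm_ring
    rw [e1]
    noncomm_ring

/-- A unipotent element of finite multiplicative order differs from `1` by an additive torsion
element. -/
theorem exists_nat_mul_eq_zero_of_isNilpotent {S : Type*} [Ring S] {x : S} (hx : IsNilpotent x)
    {e : ℕ} (he : 0 < e) (h : (1 + x) ^ e = 1) : ∃ E : ℕ, 0 < E ∧ (E : S) * x = 0 := by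
  obtain ⟨r, hr, hr'⟩ := exists_one_add_pow_eq x e
  obtain ⟨n, hn⟩ := hx
  -- The equation `(1 + x)^e = 1` trades a factor `e` for a factor `-xr`; doing so `n` times
  -- produces `x^n = 0`.
  have h1 : (e : S) * x = x * (x * -r) := by
    rw [h] at hr'
    have : (e : S) * x + x ^ 2 * r = 0 := by
      have := congrArg (fun y => y - 1) hr'
      simp only [sub_self] at this
      rw [this]; abel
    rw [eq_neg_of_add_eq_zero_left this, pow_two]; noncomm_ring
  have h2 : ∀ k : ℕ, (e ^ k : S) * x = x * (x * -r) ^ k := by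
    intro k
    induction k with
    | zero => simp
    | succ k ih =>
      rw [pow_succ, mul_assoc, h1, ← mul_assoc, ih, mul_assoc, ← pow_succ]
  refine ⟨e ^ n, pow_pos he n, ?_⟩
  rw [Nat.cast_pow, h2, (hr.neg_right).mul_pow, hn, zero_mul, mul_zero]

variable {G S : Type*} [Group G] [Ring S] (ρ : G →* S) {U : Subgroup G}

theorem finiteIndex_center_range_toHomUnits [U.FiniteIndex]
    (hU : ∀ u ∈ U, ∀ g, Commute (ρ u) (ρ g)) :
    (Subgroup.center ρ.toHomUnits.range).FiniteIndex := by
  have hsurj := ρ.toHomUnits.rangeRestrict_surjective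
  have hle : U.map ρ.toHomUnits.rangeRestrict ≤ Subgroup.center ρ.toHomUnits.range := by
    rintro _ ⟨u, hu, rfl⟩
    rw [Subgroup.mem_center_iff]
    intro a
    obtain ⟨g, rfl⟩ := hsurj a
    exact Subtype.ext (Units.ext (hU u hu g).eq.symm)
  have : (U.map ρ.toHomUnits.rangeRestrict).FiniteIndex :=
    ⟨fun h => Subgroup.FiniteIndex.index_ne_zero (H := U)
      (Nat.eq_zero_of_zero_dvd (h ▸ U.index_map_dvd hsurj))⟩
  exact Subgroup.finiteIndex_of_le hle

theorem map_commutator_of_surjective {H : Type*} [Group H] {f : G →* H}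
    (hf : Function.Surjective f) : (commutator G).map f = commutator H := by
  rw [commutator_def, Subgroup.map_commutator, Subgroup.map_top_of_surjective f hf, commutator_def]

theorem augSpan_commutator_eq :
    augSpan ρ (commutator G) = augSpan (((Units.coeHom S).comp ρ.toHomUnits.range.subtype).comp
      (commutator ρ.toHomUnits.range).subtype) ⊤ := by
  rw [augSpan_comp, ← MonoidHom.range_eq_map, Subgroup.range_subtype,
    ← map_commutator_of_surjective ρ.toHomUnits.rangeRestrict_surjective, ← augSpan_comp]
  rfl

/-- In characteristic `p`, `(y - 1)^(p^n) = y^(p^n) - 1`, so unipotent commutators are `p`-elements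
and the derived subgroup of the image is a finite `p`-group. -/
theorem isNilpotent_augSpan_commutator_of_charP {p : ℕ} (hp : p.Prime) [CharP S p]
    [U.FiniteIndex] (hU : ∀ u ∈ U, ∀ g, Commute (ρ u) (ρ g))
    (hnil : ∀ a b : G, IsNilpotent (ρ ⁅a, b⁆ - 1)) : IsNilpotent (augSpan ρ (commutator G)) := by
  have := Fact.mk hp
  have := finiteIndex_center_range_toHomUnits ρ hU
  have hP : IsPGroup p (commutator ρ.toHomUnits.range) := by
    refine isPGroup_commutator_of_finiteIndex_center hp fun a b => ?_
    obtain ⟨a, rfl⟩ := ρ.toHomUnits.rangeRestrict_surjective a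
    obtain ⟨b, rfl⟩ := ρ.toHomUnits.rangeRestrict_surjective b
    obtain ⟨n, hn⟩ := hnil a b
    refine ⟨n, ?_⟩
    rw [← map_commutatorElement]
    refine Subtype.ext (Units.ext ?_)
    change ρ ⁅a, b⁆ ^ p ^ n = 1
    have h0 : (ρ ⁅a, b⁆ - 1) ^ p ^ n = 0 := pow_eq_zero_of_le (Nat.lt_pow_self hp.one_lt).le hn
    rwa [sub_pow_char_pow_of_commute _ _ (Commute.one_right _), one_pow, sub_eq_zero] at h0
  have := finite_commutatorSet_of_finiteIndex_center (A := ρ.toHomUnits.range)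
  rw [augSpan_commutator_eq]
  exact isNilpotent_augSpan_of_isPGroup hp hP _

theorem exists_augSpan_pow_le_prime {p : ℕ} (hp : p.Prime)
    [U.FiniteIndex] (hU : ∀ u ∈ U, ∀ g, Commute (ρ u) (ρ g))
    (hnil : ∀ a b : G, IsNilpotent (ρ ⁅a, b⁆ - 1)) :
    ∃ k, augSpan ρ (commutator G) ^ k ≤ Submodule.span ℤ {(p : S)} * ⊤ := by
  let I : Ideal S :=
    { (Submodule.span ℤ {(p : S)} * ⊤ : Submodule ℤ S).toAddSubmonoid with
      smul_mem' := by
        intro s x hx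
        have hx' : x ∈ Submodule.span ℤ {(p : S)} * ⊤ := hx
        obtain ⟨y, -, rfl⟩ := Submodule.mem_span_singleton_mul.1 hx'
        change s * (p * y) ∈ Submodule.span ℤ {(p : S)} * ⊤
        rw [← mul_assoc, (Nat.commute_cast s p).eq, mul_assoc]
        exact Submodule.mul_mem_mul (Submodule.mem_span_singleton_self _) Submodule.mem_top }
  have hI : ∀ x, x ∈ I ↔ x ∈ Submodule.span ℤ {(p : S)} * ⊤ := fun _ => Iff.rfl
  have : I.IsTwoSided := by
    refine ⟨fun {a} b ha => ?_⟩
    rw [hI] at *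
    have h := Submodule.mul_mem_mul ha (Submodule.mem_top (x := b))
    rw [mul_assoc] at h
    exact (mul_le_mul_right le_top _ : _ * (⊤ * ⊤ : Submodule ℤ S) ≤ _) h
  obtain hS | hS := subsingleton_or_nontrivial (S ⧸ I)
  · refine ⟨0, fun x _ => (hI x).1 ?_⟩
    exact Ideal.Quotient.eq_zero_iff_mem.1 (Subsingleton.elim _ _)
  have : CharP (S ⧸ I) p := by
    rw [CharP.charP_iff_prime_eq_zero hp, ← map_natCast (Ideal.Quotient.mk I),
      Ideal.Quotient.eq_zero_iff_mem, hI]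
    exact Submodule.mem_span_singleton_mul.2 ⟨1, Submodule.mem_top, mul_one _⟩
  obtain ⟨k, hk⟩ := isNilpotent_augSpan_commutator_of_charP
    ((Ideal.Quotient.mk I : S →* S ⧸ I).comp ρ) hp (U := U)
    (fun u hu g => (hU u hu g).map (Ideal.Quotient.mk I))
    (fun a b => by simpa using (hnil a b).map (Ideal.Quotient.mk I))
  rw [← map_augSpan, ← Submodule.map_pow, Submodule.zero_eq_bot] at hk
  refine ⟨k, fun x hx => ?_⟩
  have := hk ▸ Submodule.mem_map_of_mem (f := (Ideal.Quotient.mk I).toIntAlgHom.toLinearMap) hx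
  exact (hI x).1 (Ideal.Quotient.eq_zero_iff_mem.1 ((Submodule.mem_bot ℤ).1 this))

theorem exists_augSpan_pow_le_nat
    [U.FiniteIndex] (hU : ∀ u ∈ U, ∀ g, Commute (ρ u) (ρ g))
    (hnil : ∀ a b : G, IsNilpotent (ρ ⁅a, b⁆ - 1)) (E : ℕ) :
    E ≠ 0 → ∃ k, augSpan ρ (commutator G) ^ k ≤ Submodule.span ℤ {(E : S)} * ⊤ := by
  induction E using Nat.recOnMul with
  | zero => simp
  | one =>
    refine fun _ => ⟨0, fun x _ => ?_⟩
    rw [← one_mul x]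
    exact Submodule.mul_mem_mul (Submodule.subset_span (by simp)) Submodule.mem_top
  | prime p hp => exact fun _ => exists_augSpan_pow_le_prime ρ hp hU hnil
  | mul a b iha ihb =>
    intro hab
    obtain ⟨k, hk⟩ := iha (left_ne_zero_of_mul hab)
    obtain ⟨l, hl⟩ := ihb (right_ne_zero_of_mul hab)
    refine ⟨k + l, ?_⟩
    rw [pow_add]
    refine (mul_le_mul' hk hl).trans (Submodule.mul_le.2 ?_)
    intro x hx y hy
    obtain ⟨x, -, rfl⟩ := Submodule.mem_span_singleton_mul.1 hx
    obtain ⟨y, -, rfl⟩ := Submodule.mem_span_singleton_mul.1 hy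
    have : (a : S) * x * (b * y) = ((a * b : ℕ) : S) * (x * y) := by
      rw [mul_assoc, ← mul_assoc x, (Nat.commute_cast x b).eq]; push_cast; noncomm_ring
    rw [this]
    exact Submodule.mul_mem_mul (Submodule.mem_span_singleton_self _) Submodule.mem_top

/-- If the image of `G` is central-by-finite and every commutator acts unipotently, then the derived
subgroup acts unipotently. -/
theorem isNilpotent_augSpan_commutator_of_central
    [U.FiniteIndex] (hU : ∀ u ∈ U, ∀ g, Commute (ρ u) (ρ g))
    (hnil : ∀ a b : G, IsNilpotent (ρ ⁅a, b⁆ - 1)) : IsNilpotent (augSpan ρ (commutator G)) := by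
  have := finiteIndex_center_range_toHomUnits ρ hU
  have := finite_commutatorSet_of_finiteIndex_center (A := ρ.toHomUnits.range)
  have hfin : Finite (commutator ρ.toHomUnits.range) := inferInstance
  have hmem : ∀ g ∈ commutator G, ρ.toHomUnits.rangeRestrict g ∈ commutator ρ.toHomUnits.range :=
    fun g hg => map_commutator_of_surjective ρ.toHomUnits.rangeRestrict_surjective ▸
      Subgroup.mem_map_of_mem _ hg
  have hpow : ∀ g ∈ commutator G, ρ g ^ Nat.card (commutator ρ.toHomUnits.range) = 1 := by
    intro g hg
    have := congrArg (fun x => ((x : ρ.toHomUnits.range) : Sˣ).val) (congrArg Subtype.val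
      (pow_card_eq_one' (x := (⟨_, hmem g hg⟩ : commutator ρ.toHomUnits.range))))
    exact this
  -- The elements differing from 1 by additive torsion form a subgroup. It contains all commutators,
  -- whose images are unipotent of finite order.
  let D : Subgroup G :=
    { carrier := {g | ∃ E : ℕ, 0 < E ∧ (E : S) * (ρ g - 1) = 0}
      one_mem' := ⟨1, one_pos, by simp⟩
      mul_mem' := by
        rintro g h ⟨E, hE, hE'⟩ ⟨F, hF, hF'⟩
        refine ⟨E * F, Nat.mul_pos hE hF, ?_⟩
        have : ρ (g * h) - 1 = ρ g * (ρ h - 1) + (ρ g - 1) := by rw [map_mul]; noncomm_ring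
        rw [this, mul_add]
        have h1 : ((E * F : ℕ) : S) * (ρ g * (ρ h - 1)) = E * (ρ g * (F * (ρ h - 1))) := by
          rw [← mul_assoc (ρ g) (F : S), (Nat.commute_cast (ρ g) F).eq]; push_cast; noncomm_ring
        have h2 : ((E * F : ℕ) : S) * (ρ g - 1) = F * (E * (ρ g - 1)) := by
          rw [mul_comm E F]; push_cast; rw [mul_assoc]
        rw [h1, h2, hE', hF']; simp
      inv_mem' := by
        rintro g ⟨E, hE, hE'⟩
        refine ⟨E, hE, ?_⟩
        have : ρ g⁻¹ - 1 = (ρ g - 1) * -ρ g⁻¹ := by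
          rw [sub_mul, mul_neg, ← map_mul]; simp; abel
        rw [this, ← mul_assoc, hE', zero_mul] }
  have hD : commutator G ≤ D := by
    rw [commutator_def, Subgroup.commutator_le]
    intro a _ b _
    refine exists_nat_mul_eq_zero_of_isNilpotent (hnil a b)
      (e := Nat.card (commutator ρ.toHomUnits.range)) Nat.card_pos ?_
    rw [add_sub_cancel]
    exact hpow _ (Subgroup.commutator_mem_commutator (Subgroup.mem_top _) (Subgroup.mem_top _))
  have hE : ∃ E : ℕ, E ≠ 0 ∧ ∀ g ∈ commutator G, (E : S) * (ρ g - 1) = 0 := by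
    have : ∀ a : commutator ρ.toHomUnits.range, ∃ E : ℕ, 0 < E ∧
        (E : S) * (((a : ρ.toHomUnits.range) : Sˣ).val - 1) = 0 := by
      rintro ⟨a, ha⟩
      rw [← map_commutator_of_surjective ρ.toHomUnits.rangeRestrict_surjective] at ha
      obtain ⟨g, hg, rfl⟩ := ha
      exact hD hg
    choose E hE hE' using this
    have := Fintype.ofFinite (commutator ρ.toHomUnits.range)
    refine ⟨∏ a, E a, Finset.prod_ne_zero_iff.2 fun a _ => (hE a).ne', fun g hg => ?_⟩
    obtain ⟨F, hF⟩ := Finset.dvd_prod_of_mem E (Finset.mem_univ ⟨_, hmem g hg⟩)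
    rw [hF, mul_comm, Nat.cast_mul, mul_assoc]
    exact (congrArg _ (hE' ⟨_, hmem g hg⟩)).trans (mul_zero _)
  obtain ⟨E, hE0, hE⟩ := hE
  obtain ⟨k, hk⟩ := exists_augSpan_pow_le_nat ρ hU hnil E hE0
  -- The first `k` factors supply a multiple of `E`, which annihilates the last one.
  refine ⟨k + 1, ?_⟩
  rw [pow_succ, Submodule.zero_eq_bot, eq_bot_iff]
  refine (mul_le_mul_left hk _).trans ?_
  rw [augSpan, mul_assoc, Submodule.mul_le]
  intro x hx y hy
  obtain ⟨n, rfl⟩ := Submodule.mem_span_singleton.1 hx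
  have hy0 : (E : S) * y = 0 := by
    induction hy using Submodule.mul_induction_on' with
    | mem_mul_mem m _ z hz =>
      rw [← mul_assoc, ← (Nat.commute_cast m E).eq, mul_assoc]
      have : (E : S) * z = 0 := by
        induction hz using Submodule.span_induction with
        | mem z hz => obtain ⟨g, hg, rfl⟩ := hz; exact hE g hg
        | zero => simp
        | add a b _ _ ha hb => rw [mul_add, ha, hb, add_zero]
        | smul c a _ ha => rw [mul_smul_comm, ha, smul_zero]
      rw [this, mul_zero]
    | add a _ b _ ha hb => rw [mul_add, ha, hb, add_zero]
  rw [smul_mul_assoc, hy0, smul_zero]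
  exact zero_mem _

end CentralByFinite

/-! ### Unipotency for abelian-by-finite images. -/

section UnipotentAction

theorem commutatorElement_mul_left' {G : Type*} [Group G] (u a b : G) :
    ⁅u * a, b⁆ = u * ⁅a, b⁆ * u⁻¹ * ⁅u, b⁆ := by
  simp only [commutatorElement_def]; group

theorem commutatorElement_mul_right' {G : Type*} [Group G] (u a b : G) :
    ⁅u, a * b⁆ = ⁅u, a⁆ * (a * ⁅u, b⁆ * a⁻¹) := by
  simp only [commutatorElement_def]; group

variable {G S : Type*} [Group G] [Ring S] (ρ : G →* S)

theorem map_conj_of_commute {x y : G} (h : Commute (ρ x) (ρ y)) : ρ (x * y * x⁻¹) = ρ y := by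
  rw [map_mul, map_mul, h.eq, mul_assoc, ← map_mul]; simp

theorem map_commutatorElement_eq_one {x y : G} (h : Commute (ρ x) (ρ y)) : ρ ⁅x, y⁆ = 1 := by
  rw [commutatorElement_def, map_mul, map_conj_of_commute ρ h, ← map_mul]; simp

theorem commute_of_map_commutatorElement_eq_one {x y : G} (h : ρ ⁅x, y⁆ = 1) :
    Commute (ρ x) (ρ y) := by
  have : x * y = ⁅x, y⁆ * (y * x) := by rw [commutatorElement_def]; group
  change ρ x * ρ y = ρ y * ρ x
  rw [← map_mul, this, map_mul, h, one_mul, map_mul]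

variable {T U : Subgroup G} [T.Normal] [U.Normal] [T.FiniteIndex]

/-- Since `T` acts commutatively, `ρ ⁅u, g⁆` depends only on `u` and the coset of `g` modulo `T`. So
finitely many subgroups `K q ⊓ T` suffice; their spans are nilpotent and commute, hence have
nilpotent sum. -/
theorem isNilpotent_augSpan_commutator_top (hUT : U ≤ T)
    (hT : ∀ t ∈ T, ∀ s ∈ T, Commute (ρ t) (ρ s))
    (hK : ∀ b : G, ∃ t ∈ T, ∃ K : Subgroup G, IsNilpotent (augSpan ρ K) ∧
      ∀ u ∈ U, ⁅u, t * b⁆ ∈ K) :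
    IsNilpotent (augSpan ρ ⁅U, (⊤ : Subgroup G)⁆) := by
  choose t ht K hK hmem using fun q : G ⧸ T => hK q.out
  let Γ : Submodule ℤ S := Submodule.span ℤ (ρ '' (T : Set G))
  let L : G ⧸ T → Submodule ℤ S := fun q => augSpan ρ (K q ⊓ T)
  have hL : ∀ q, IsNilpotent (L q) := fun q => (hK q).of_le
    ((augSpan_le ρ).2 fun d hd => sub_one_mem_augSpan ρ hd.1)
  have hcomm : ∀ X Y : Set S, (∀ x ∈ X, ∀ y ∈ Y, Commute x y) →
      Commute (Submodule.span ℤ X) (Submodule.span ℤ Y) := by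
    intro X Y h
    change _ * _ = _ * _
    rw [Submodule.span_mul_span, Submodule.span_mul_span]
    congr 1
    ext z
    constructor
    · rintro ⟨x, hx, y, hy, rfl⟩; exact ⟨y, hy, x, hx, (h x hx y hy).eq.symm⟩
    · rintro ⟨y, hy, x, hx, rfl⟩; exact ⟨x, hx, y, hy, (h x hx y hy).eq⟩
  have hLL : ∀ q r, Commute (L q) (L r) := by
    intro q r
    refine hcomm _ _ ?_
    rintro _ ⟨d, hd, rfl⟩ _ ⟨e, he, rfl⟩
    exact ((hT d hd.2 e he.2).sub_left (Commute.one_left _)).sub_right (Commute.one_right _)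
  have hΓL : ∀ q, Commute Γ (L q) := by
    intro q
    refine hcomm _ _ ?_
    rintro _ ⟨d, hd, rfl⟩ _ ⟨e, he, rfl⟩
    exact (hT d hd e he.2).sub_right (Commute.one_right _)
  have := Fintype.ofFinite (G ⧸ T)
  have hsum : IsNilpotent (∑ q, L q) := Commute.isNilpotent_sum (fun q _ => hL q)
    fun q r _ _ => hLL q r
  have hΓsum : Commute Γ (∑ q, L q) := Commute.sum_right _ _ _ fun q _ => hΓL q
  have hΓ1 : (1 : S) ∈ Γ := Submodule.subset_span ⟨1, T.one_mem, map_one ρ⟩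
  have hΓmul : ∀ g ∈ T, ∀ x ∈ Γ * ∑ q, L q, ρ g * x ∈ Γ * ∑ q, L q := by
    intro g hg x hx
    have h := Submodule.mul_mem_mul (Submodule.subset_span ⟨g, hg, rfl⟩ : ρ g ∈ Γ) hx
    rw [← mul_assoc] at h
    refine (mul_le_mul_left ?_ _ : _ ≤ Γ * ∑ q, L q) h
    rw [Submodule.span_mul_span, Submodule.span_le]
    rintro _ ⟨_, ⟨x, hx, rfl⟩, _, ⟨y, hy, rfl⟩, rfl⟩
    exact Submodule.subset_span ⟨x * y, T.mul_mem hx hy, map_mul ρ x y⟩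
  -- The factor `Γ` makes this closed under products, as `ρ (gh) - 1 = ρ g (ρ h - 1) + (ρ g - 1)`;
  -- it commutes with the sum, so nilpotency survives.
  let D : Subgroup G :=
    { carrier := {g | g ∈ T ∧ ρ g - 1 ∈ Γ * ∑ q, L q}
      one_mem' := ⟨T.one_mem, by simp⟩
      mul_mem' := by
        rintro g h ⟨hg, hg'⟩ ⟨hh, hh'⟩
        refine ⟨T.mul_mem hg hh, ?_⟩
        have : ρ (g * h) - 1 = ρ g * (ρ h - 1) + (ρ g - 1) := by rw [map_mul]; noncomm_ring
        rw [this]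
        exact add_mem (hΓmul g hg _ hh') hg'
      inv_mem' := by
        rintro g ⟨hg, hg'⟩
        refine ⟨T.inv_mem hg, ?_⟩
        have : ρ g⁻¹ - 1 = -(ρ g⁻¹ * (ρ g - 1)) := by rw [mul_sub, ← map_mul]; simp
        rw [this]
        exact neg_mem (hΓmul _ (T.inv_mem hg) _ hg') }
  have hD : ⁅U, (⊤ : Subgroup G)⁆ ≤ D := by
    rw [Subgroup.commutator_le]
    intro u hu g _
    have hmemT : ∀ g : G, ⁅u, g⁆ ∈ T := fun g => hUT (by
      rw [commutatorElement_def, mul_assoc, mul_assoc]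
      refine U.mul_mem hu ?_
      rw [← mul_assoc]
      exact Subgroup.Normal.conj_mem inferInstance _ (U.inv_mem hu) g)
    let q : G ⧸ T := g
    obtain ⟨⟨r, hr⟩, hr'⟩ := QuotientGroup.mk_out_eq_mul T g
    have hr' : q.out = g * r := hr'
    let s := g * (t q * q.out)⁻¹
    have hs : s ∈ T := by
      have : s = g * r⁻¹ * g⁻¹ * (t q)⁻¹ := by simp only [s, hr']; group
      rw [this]
      exact T.mul_mem (Subgroup.Normal.conj_mem inferInstance _ (T.inv_mem hr) g)
        (T.inv_mem (ht q))
    have hg : g = s * (t q * q.out) := (inv_mul_cancel_right g _).symm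
    refine ⟨hmemT g, ?_⟩
    have hρ : ρ ⁅u, g⁆ = ρ ⁅u, t q * q.out⁆ := by
      conv_lhs => rw [hg]
      rw [commutatorElement_mul_right', map_mul, map_commutatorElement_eq_one ρ (hT u (hUT hu) s hs),
        one_mul, map_conj_of_commute ρ (hT s hs _ (hmemT _))]
    rw [hρ, ← one_mul (ρ _ - 1)]
    refine Submodule.mul_mem_mul hΓ1 ?_
    have hle : L q ≤ ∑ q, L q := Finset.single_le_sum (f := L) (fun _ _ => bot_le)
      (Finset.mem_univ q)
    exact hle (sub_one_mem_augSpan ρ ⟨hmem q u hu, hmemT _⟩)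
  refine IsNilpotent.of_le ?_ ((augSpan_le ρ).2 fun d hd => (hD hd).2)
  obtain ⟨m, hm⟩ := hsum
  exact ⟨m, by rw [hΓsum.mul_pow, hm, mul_zero]⟩

/-- A criterion for the derived subgroup to act unipotently, for a group that acts through an
abelian-by-finite group. -/
theorem isNilpotent_augSpan_commutator_of_span_eq_top [U.FiniteIndex]
    (hρ : Submodule.span ℤ (Set.range ρ) = ⊤) (hUT : U ≤ T)
    (hT : ∀ t ∈ T, ∀ s ∈ T, Commute (ρ t) (ρ s))
    (hK : ∀ b : G, ∃ t ∈ T, ∃ K : Subgroup G, IsNilpotent (augSpan ρ K) ∧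
      ∀ u ∈ U, ⁅u, t * b⁆ ∈ K)
    (hnil : ∀ a b : G, ∃ u ∈ U, ∃ v ∈ U, IsNilpotent (ρ ⁅u * a, v * b⁆ - 1)) :
    IsNilpotent (augSpan ρ (commutator G)) := by
  have hN := isNilpotent_augSpan_commutator_top ρ hUT hT hK
  have := augIdeal_isTwoSided ρ hρ ⁅U, (⊤ : Subgroup G)⁆
  refine isNilpotent_augSpan_of_quotient ρ hρ _ _ hN ?_
  set π := Ideal.Quotient.mk (augIdeal ρ ⁅U, (⊤ : Subgroup G)⁆) with hπ
  let σ : G →* S ⧸ augIdeal ρ ⁅U, (⊤ : Subgroup G)⁆ := (π : S →* _).comp ρ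
  have hU : ∀ u ∈ U, ∀ g, Commute (σ u) (σ g) := by
    intro u hu g
    refine commute_of_map_commutatorElement_eq_one σ ?_
    have := sub_one_mem_augIdeal ρ (Subgroup.commutator_mem_commutator hu (Subgroup.mem_top g))
    have := Ideal.Quotient.eq_zero_iff_mem.2 this
    rwa [map_sub, map_one, sub_eq_zero] at this
  refine isNilpotent_augSpan_commutator_of_central σ hU fun a b => ?_
  obtain ⟨u, hu, v, hv, h⟩ := hnil a b
  have h := h.map π
  -- In the quotient `U` acts centrally, so changing `a` and `b` by elements of `U` does not affect
  -- the image of their commutator.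
  have e : σ ⁅a, b⁆ = σ ⁅u * a, v * b⁆ := by
    rw [commutatorElement_mul_left', map_mul, map_commutatorElement_eq_one σ (hU u hu _), mul_one,
      map_conj_of_commute σ (hU u hu _), commutatorElement_mul_right', map_mul,
      map_commutatorElement_eq_one σ (hU v hv _).symm, one_mul, map_conj_of_commute σ (hU v hv _)]
  rw [e]
  rwa [map_sub, map_one] at h

theorem isNilpotent_augSpan_comp_iff {S' : Type*} [Ring S'] (f : S →+* S')
    (hf : Function.Injective f) (D : Subgroup G) :
    IsNilpotent (augSpan ((f : S →* S').comp ρ) D) ↔ IsNilpotent (augSpan ρ D) := by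
  rw [← map_augSpan]
  refine ⟨fun ⟨n, hn⟩ => ⟨n, ?_⟩, fun h => h.map_submodule f⟩
  rw [← Submodule.map_pow, Submodule.zero_eq_bot] at hn
  exact Submodule.map_injective_of_injective (f := f.toIntAlgHom.toLinearMap) hf
    (hn.trans (Submodule.map_bot _).symm)

theorem span_range_of_eq_top : Submodule.span ℤ (Set.range (MonoidAlgebra.of ℤ G)) = ⊤ := by
  rw [eq_top_iff]
  intro x _
  induction x using MonoidAlgebra.induction_on with
  | of g => exact Submodule.subset_span ⟨g, rfl⟩
  | add x y hx hy => exact add_mem (hx trivial) (hy trivial)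
  | smul r x hx => exact Submodule.smul_mem _ r (hx trivial)

/-- A criterion for the derived subgroup to act unipotently, for a group that acts through an
abelian-by-finite group. -/
theorem isNilpotent_augSpan_commutator [U.FiniteIndex] (hUT : U ≤ T)
    (hT : ∀ t ∈ T, ∀ s ∈ T, Commute (ρ t) (ρ s))
    (hK : ∀ b : G, ∃ t ∈ T, ∃ K : Subgroup G, IsNilpotent (augSpan ρ K) ∧
      ∀ u ∈ U, ⁅u, t * b⁆ ∈ K)
    (hnil : ∀ a b : G, ∃ u ∈ U, ∃ v ∈ U, IsNilpotent (ρ ⁅u * a, v * b⁆ - 1)) :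
    IsNilpotent (augSpan ρ (commutator G)) := by
  -- Two-sidedness of the ideal needs `ρ G` to span, so the ring is replaced by the subring spanned
  -- by the image.
  let F : MonoidAlgebra ℤ G →+* S := (MonoidAlgebra.lift ℤ S G ρ).toRingHom
  let σ : G →* F.range := (F.rangeRestrict : MonoidAlgebra ℤ G →* F.range).comp
    (MonoidAlgebra.of ℤ G)
  have hσ : Submodule.span ℤ (Set.range σ) = ⊤ :=
    span_range_comp_eq_top _ span_range_of_eq_top _ F.rangeRestrict_surjective
  have hinj : Function.Injective F.range.subtype := Subtype.val_injective
  have hσρ : (F.range.subtype : F.range →* S).comp σ = ρ := by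
    ext g
    change MonoidAlgebra.lift ℤ S G ρ (MonoidAlgebra.of ℤ G g) = ρ g
    simp
  have hσg : ∀ g, F.range.subtype (σ g) = ρ g := fun g => DFunLike.congr_fun hσρ g
  have hcomm : ∀ x y, Commute (ρ x) (ρ y) → Commute (σ x) (σ y) := by
    intro x y h
    apply hinj
    rw [map_mul, map_mul, hσg, hσg, h.eq]
  rw [← hσρ, isNilpotent_augSpan_comp_iff _ _ hinj]
  refine isNilpotent_augSpan_commutator_of_span_eq_top σ hσ hUT
    (fun t ht s hs => hcomm _ _ (hT t ht s hs)) (fun b => ?_) fun a b => ?_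
  · obtain ⟨t, ht, K, hK, h⟩ := hK b
    refine ⟨t, ht, K, ?_, h⟩
    rwa [← hσρ, isNilpotent_augSpan_comp_iff _ _ hinj] at hK
  · obtain ⟨u, hu, v, hv, h⟩ := hnil a b
    refine ⟨u, hu, v, hv, ?_⟩
    rwa [← IsNilpotent.map_iff hinj, map_sub, map_one, hσg]

end UnipotentAction

/-! ### Conjugation on abelian normal subgroups. -/

section IteratedCentralizer

variable {G : Type*} [Group G]

/-- The set of all `x` for which every iterated commutator `⁅⁅x, d₁⁆, …, dⱼ⁆` with
`d₁, …, dⱼ ∈ D` lies in `N`. -/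
def iteratedCentralizer (D : Subgroup G) (N : Set G) : ℕ → Set G
  | 0 => N
  | j + 1 => {x | ∀ d ∈ D, ⁅x, d⁆ ∈ iteratedCentralizer D N j}

theorem iteratedCentralizer_mono (D : Subgroup G) {N N' : Set G} (h : N ⊆ N') (j : ℕ) :
    iteratedCentralizer D N j ⊆ iteratedCentralizer D N' j := by
  induction j with
  | zero => exact h
  | succ j ih => exact fun x hx d hd => ih (hx d hd)

theorem iteratedCentralizer_add (D : Subgroup G) (N : Set G) (i j : ℕ) :
    iteratedCentralizer D (iteratedCentralizer D N i) j = iteratedCentralizer D N (i + j) := by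
  induction j with
  | zero => rfl
  | succ j ih =>
    ext x
    change (∀ d ∈ D, _) ↔ (∀ d ∈ D, ⁅x, d⁆ ∈ iteratedCentralizer D N (i + j))
    rw [ih]

theorem preimage_iteratedCentralizer {H : Type*} [Group H] (f : G →* H) (D : Subgroup G)
    (N : Set H) (j : ℕ) :
    f ⁻¹' iteratedCentralizer (D.map f) N j = iteratedCentralizer D (f ⁻¹' N) j := by
  induction j with
  | zero => rfl
  | succ j ih =>
    ext x
    change (∀ d ∈ D.map f, _) ↔ (∀ d ∈ D, _)
    rw [← ih]
    simp [map_commutatorElement]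

variable (M : Subgroup G) [M.Normal] [hM : IsMulCommutative M]

open scoped IsMulCommutative in
/-- The ring of endomorphisms of an abelian subgroup. It is a type synonym, so that its only
`ℤ`-module structure is the one that comes from the ring structure. -/
def AbelianEnd (M : Subgroup G) [IsMulCommutative M] : Type _ := AddMonoid.End (Additive M)

open scoped IsMulCommutative in
noncomputable instance : Ring (AbelianEnd M) := inferInstanceAs (Ring (AddMonoid.End (Additive M)))

open scoped IsMulCommutative in
instance : FunLike (AbelianEnd M) (Additive M) (Additive M) :=
  inferInstanceAs (FunLike (AddMonoid.End (Additive M)) (Additive M) (Additive M))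

open scoped IsMulCommutative in
instance : AddMonoidHomClass (AbelianEnd M) (Additive M) (Additive M) :=
  inferInstanceAs (AddMonoidHomClass (AddMonoid.End (Additive M)) (Additive M) (Additive M))

open scoped IsMulCommutative in
/-- The conjugation action of a group on an abelian normal subgroup, as a ring-valued
representation. -/
noncomputable def conjRep : G →* AbelianEnd M where
  toFun g := (MonoidHom.toAdditive (MulAut.conjNormal (H := M) g).toMonoidHom :
    Additive M →+ Additive M)
  map_one' := by rw [map_one]; rfl
  map_mul' g h := by rw [map_mul]; rfl

open scoped IsMulCommutative in
theorem conjRep_sub_one_apply (g : G) (x : Additive M) :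
    (((conjRep M g - 1) x).toMul : G) = ⁅g, (x.toMul : G)⁆ := by
  change ((MulAut.conjNormal (H := M) g x.toMul / x.toMul : M) : G) = _
  rw [Subgroup.coe_div, MulAut.conjNormal_apply, div_eq_mul_inv, commutatorElement_def]

open scoped IsMulCommutative in
theorem isNilpotent_augSpan_conjRep (K : Subgroup G) (hK : Group.IsNilpotent K)
    (hMK : M ≤ Subgroup.normalizer (K : Set G)) : IsNilpotent (augSpan (conjRep M) K) := by
  obtain ⟨n, hn⟩ := (Subgroup.isNilpotent_iff_lowerCentralSeries K).1 hK
  let Q : ℕ → Submodule ℤ (AbelianEnd M) := fun j => AddSubgroup.toIntSubmodule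
    { carrier := {s | ∀ x, ((s x).toMul : G) ∈ K.lowerCentralSeries j}
      zero_mem' := fun x => one_mem _
      add_mem' := fun hs ht x => mul_mem (hs x) (ht x)
      neg_mem' := fun hs x => inv_mem (hs x) }
  have key : ∀ j, augSpan (conjRep M) K ^ (j + 1) ≤ Q j := by
    intro j
    induction j with
    | zero =>
      rw [zero_add, pow_one, augSpan_le]
      intro k hk x
      rw [conjRep_sub_one_apply, commutatorElement_def, mul_assoc, mul_assoc]
      refine K.mul_mem hk ?_
      rw [← mul_assoc]
      exact (Subgroup.mem_normalizer_iff.1 (hMK x.toMul.2) _).1 (K.inv_mem hk)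
    | succ j ih =>
      rw [pow_succ', augSpan]
      refine (mul_le_mul_right ih _).trans ?_
      rw [← Submodule.span_eq (Q j), Submodule.span_mul_span, Submodule.span_le]
      rintro _ ⟨_, ⟨g, hg, rfl⟩, v, hv, rfl⟩ x
      change ((((conjRep M g - 1) (v x))).toMul : G) ∈ _
      rw [conjRep_sub_one_apply, Subgroup.lowerCentralSeries_succ, Subgroup.commutator_comm]
      exact Subgroup.commutator_mem_commutator hg (hv x)
  -- One extra factor is needed: the first only moves `M` into `K`, and each later one descends a
  -- step in the lower central series.
  refine ⟨n + 1, ?_⟩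
  rw [Submodule.zero_eq_bot, eq_bot_iff]
  intro s hs
  rw [Submodule.mem_bot]
  refine DFunLike.ext _ _ fun x => ?_
  have := key n hs x
  rw [hn, Subgroup.mem_bot] at this
  exact congrArg Additive.ofMul (Subtype.ext this)

open scoped IsMulCommutative in
theorem subset_iteratedCentralizer_of_augSpan {D : Subgroup G} {m : ℕ}
    (h : augSpan (conjRep M) D ^ m = 0) : (M : Set G) ⊆ iteratedCentralizer D {1} m := by
  have key : ∀ j, ∀ x : Additive M, (∀ s ∈ augSpan (conjRep M) D ^ j, s x = 0) →
      (x.toMul : G) ∈ iteratedCentralizer D {1} j := by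
    intro j
    induction j with
    | zero =>
      intro x hx
      have : x = 0 := hx 1 (by rw [pow_zero]; exact Submodule.one_le.1 le_rfl)
      subst this
      rfl
    | succ j ih =>
      intro x hx d hd
      have h1 := ih (-((conjRep M d - 1) x)) (fun s hs => by
        rw [map_neg, neg_eq_zero]
        refine hx (s * (conjRep M d - 1)) ?_
        rw [pow_succ]
        exact Submodule.mul_mem_mul hs (sub_one_mem_augSpan _ hd))
      have h2 : (((-((conjRep M d - 1) x)).toMul : M) : G) = ⁅(x.toMul : G), d⁆ := by
        rw [toMul_neg, Subgroup.coe_inv, conjRep_sub_one_apply, commutatorElement_inv]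
      rwa [h2] at h1
  intro x hx
  refine key m (Additive.ofMul ⟨x, hx⟩) fun s hs => ?_
  rw [h, Submodule.zero_eq_bot, Submodule.mem_bot] at hs
  rw [hs]; rfl

theorem exists_subset_iteratedCentralizer_of_isMulCommutative {T U : Subgroup G} [T.Normal]
    [U.Normal] [T.FiniteIndex] [U.FiniteIndex] (hUT : U ≤ T)
    (hT : ∀ c ∈ ⁅T, T⁆, ∀ x ∈ M, Commute c x)
    (hK : ∀ b : G, ∃ t ∈ T, ∃ K : Subgroup G, Group.IsNilpotent K ∧
      M ≤ Subgroup.normalizer (K : Set G) ∧ ∀ u ∈ U, ⁅u, t * b⁆ ∈ K)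
    (hnil : ∀ a b : G, ∃ u ∈ U, ∃ v ∈ U, ∃ K : Subgroup G, Group.IsNilpotent K ∧
      M ≤ Subgroup.normalizer (K : Set G) ∧ ⁅u * a, v * b⁆ ∈ K) :
    ∃ m, (M : Set G) ⊆ iteratedCentralizer (commutator G) {1} m := by
  obtain ⟨m, hm⟩ := isNilpotent_augSpan_commutator (conjRep M) hUT
    (fun t ht s hs => by
      refine commute_of_map_commutatorElement_eq_one _ ?_
      rw [← sub_eq_zero]
      refine DFunLike.ext _ _ fun x => ?_
      refine congrArg Additive.ofMul (Subtype.ext ?_ : ((_ : Additive M).toMul : M) = 1)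
      exact (conjRep_sub_one_apply M _ x).trans (commutatorElement_eq_one_iff_mul_comm.2
        (hT _ (Subgroup.commutator_mem_commutator ht hs) _ x.toMul.2).eq))
    (fun b => by
      obtain ⟨t, ht, K, hK, hMK, h⟩ := hK b
      exact ⟨t, ht, K, isNilpotent_augSpan_conjRep M K hK hMK, h⟩)
    (fun a b => by
      obtain ⟨u, hu, v, hv, K, hK, hMK, h⟩ := hnil a b
      obtain ⟨n, hn⟩ := isNilpotent_augSpan_conjRep M K hK hMK
      refine ⟨u, hu, v, hv, n, ?_⟩
      have := Submodule.pow_mem_pow _ (sub_one_mem_augSpan (conjRep M) h) n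
      rwa [hn, Submodule.zero_eq_bot, Submodule.mem_bot] at this)
  exact ⟨m, subset_iteratedCentralizer_of_augSpan M hm⟩

end IteratedCentralizer

/-! ### Abelian normal sections and nilpotent subgroups normalized by `U`. -/

section Sections

variable {G : Type*} [Group G]

theorem Group.IsNilpotent.map_subgroup {H : Type*} [Group H] {K : Subgroup G}
    (hK : Group.IsNilpotent K) (f : G →* H) : Group.IsNilpotent (K.map f) := by
  rw [Subgroup.isNilpotent_iff_lowerCentralSeries] at *
  obtain ⟨n, hn⟩ := hK
  exact ⟨n, by rw [← Subgroup.map_lowerCentralSeries, hn, Subgroup.map_bot]⟩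

theorem Group.IsNilpotent.of_subgroup_le {H K : Subgroup G} (hK : Group.IsNilpotent K)
    (h : H ≤ K) : Group.IsNilpotent H := by
  rw [Subgroup.isNilpotent_iff_lowerCentralSeries] at *
  obtain ⟨n, hn⟩ := hK
  exact ⟨n, le_bot_iff.1 (hn ▸ Subgroup.lowerCentralSeries_mono n h)⟩

theorem finiteIndex_map_mk (N T : Subgroup G) [N.Normal] [T.FiniteIndex] :
    (T.map (QuotientGroup.mk' N)).FiniteIndex :=
  ⟨fun h => Subgroup.FiniteIndex.index_ne_zero (H := T)
    (Nat.eq_zero_of_zero_dvd (h ▸ T.index_map_dvd (QuotientGroup.mk'_surjective N)))⟩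

/-- A criterion for the derived subgroup to act nilpotently on an abelian normal section. -/
theorem exists_subset_iteratedCentralizer {T U M N : Subgroup G} [T.Normal]
    [U.Normal] [M.Normal] [N.Normal] [T.FiniteIndex] [U.FiniteIndex] (hUT : U ≤ T)
    (hM : ⁅M, M⁆ ≤ N) (hT : ⁅⁅T, T⁆, M⁆ ≤ N)
    (hK : ∀ b : G, ∃ t ∈ T, ∃ K : Subgroup G, Group.IsNilpotent K ∧
      M ≤ Subgroup.normalizer (K : Set G) ∧ ∀ u ∈ U, ⁅u, t * b⁆ ∈ K)
    (hnil : ∀ a b : G, ∃ u ∈ U, ∃ v ∈ U, ∃ K : Subgroup G, Group.IsNilpotent K ∧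
      M ≤ Subgroup.normalizer (K : Set G) ∧ ⁅u * a, v * b⁆ ∈ K) :
    ∃ m, (M : Set G) ⊆ iteratedCentralizer (commutator G) N m := by
  let π := QuotientGroup.mk' N
  have hπ : Function.Surjective π := QuotientGroup.mk'_surjective N
  have hcomm : ∀ {A B : Subgroup G}, ⁅A, B⁆ ≤ N → ∀ x ∈ A.map π, ∀ y ∈ B.map π,
      x * y = y * x := by
    rintro A B h _ ⟨x, hx, rfl⟩ _ ⟨y, hy, rfl⟩
    rw [← commutatorElement_eq_one_iff_mul_comm, ← map_commutatorElement]
    exact (QuotientGroup.eq_one_iff _).2 (h (Subgroup.commutator_mem_commutator hx hy))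
  have hnorm : ∀ {K : Subgroup G}, M ≤ Subgroup.normalizer (K : Set G) →
      M.map π ≤ Subgroup.normalizer (K.map π : Set (G ⧸ N)) := fun h =>
    (Subgroup.map_mono h).trans (Subgroup.le_normalizer_map π)
  have : (M.map π).Normal := Subgroup.Normal.map inferInstance π hπ
  have : (T.map π).Normal := Subgroup.Normal.map inferInstance π hπ
  have : (U.map π).Normal := Subgroup.Normal.map inferInstance π hπ
  have : (T.map π).FiniteIndex := finiteIndex_map_mk N T
  have : (U.map π).FiniteIndex := finiteIndex_map_mk N U
  have : IsMulCommutative (M.map π) :=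
    ⟨⟨fun x y => Subtype.ext (hcomm hM x x.2 y y.2)⟩⟩
  obtain ⟨m, hm⟩ := exists_subset_iteratedCentralizer_of_isMulCommutative (M.map π)
    (T := T.map π) (U := U.map π) (Subgroup.map_mono hUT)
    (fun c hc x hx => by
      rw [← Subgroup.map_commutator] at hc
      exact hcomm hT c hc x hx)
    (fun b => by
      obtain ⟨b, rfl⟩ := hπ b
      obtain ⟨t, ht, K, hK, hMK, h⟩ := hK b
      refine ⟨π t, Subgroup.mem_map_of_mem π ht, K.map π, hK.map_subgroup π, hnorm hMK, ?_⟩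
      rintro _ ⟨u, hu, rfl⟩
      rw [← map_mul, ← map_commutatorElement]
      exact Subgroup.mem_map_of_mem π (h u hu))
    (fun a b => by
      obtain ⟨a, rfl⟩ := hπ a
      obtain ⟨b, rfl⟩ := hπ b
      obtain ⟨u, hu, v, hv, K, hK, hMK, h⟩ := hnil a b
      refine ⟨π u, Subgroup.mem_map_of_mem π hu, π v, Subgroup.mem_map_of_mem π hv, K.map π,
        hK.map_subgroup π, hnorm hMK, ?_⟩
      rw [← map_mul, ← map_mul, ← map_commutatorElement]
      exact Subgroup.mem_map_of_mem π h)
  refine ⟨m, fun x hx => ?_⟩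
  have h1 : x ∈ π ⁻¹' iteratedCentralizer ((commutator G).map π) {1} m := by
    rw [map_commutator_of_surjective hπ]
    exact hm (Subgroup.mem_map_of_mem π hx)
  rw [preimage_iteratedCentralizer] at h1
  refine iteratedCentralizer_mono _ ?_ m h1
  intro y hy
  exact (QuotientGroup.eq_one_iff y).1 hy

/-- If the commutators of two cosets of a normal subgroup `U` lie in a nilpotent subgroup, then
they lie in a nilpotent subgroup normalized by `U`. -/
theorem exists_isNilpotent_le_normalizer {U H : Subgroup G} [hU : U.Normal] {a b : G}
    (hH : Group.IsNilpotent H) (h : ∀ u ∈ U, ∀ v ∈ U, ⁅u * a, v * b⁆ ∈ H) :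
    ∃ K : Subgroup G, Group.IsNilpotent K ∧ U ≤ Subgroup.normalizer (K : Set G) ∧
      (⁅a, b⁆ ∈ K) ∧ (∀ u ∈ U, ⁅u, b⁆ ∈ K) ∧ ⁅U, U⁆ ≤ K := by
  let X : Set G := {x | ∃ u ∈ U, ∃ v ∈ U, ⁅u * a, v * b⁆ = x}
  let K := Subgroup.closure X
  have hX : ∀ u ∈ U, ∀ v ∈ U, ⁅u * a, v * b⁆ ∈ K := fun u hu v hv =>
    Subgroup.subset_closure ⟨u, hu, v, hv, rfl⟩
  have hconj : ∀ w ∈ U, ∀ k ∈ K, w * k * w⁻¹ ∈ K := by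
    intro w hw
    have : K ≤ K.comap (MulAut.conj w).toMonoidHom := by
      rw [Subgroup.closure_le]
      rintro _ ⟨u, hu, v, hv, rfl⟩
      -- Conjugation by `w ∈ U` preserves the cosets `Ua` and `Ub`, hence the generating set `X`.
      have e : ∀ c g : G, w * (c * g) * w⁻¹ = w * c * (g * w⁻¹ * g⁻¹) * g := by
        intro c g; group
      change w * ⁅u * a, v * b⁆ * w⁻¹ ∈ K
      have e1 : w * ⁅u * a, v * b⁆ * w⁻¹ = ⁅w * (u * a) * w⁻¹, w * (v * b) * w⁻¹⁆ := by
        simp only [commutatorElement_def]; group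
      rw [e1, e, e]
      exact hX _ (U.mul_mem (U.mul_mem hw hu) (hU.conj_mem _ (U.inv_mem hw) _)) _
        (U.mul_mem (U.mul_mem hw hv) (hU.conj_mem _ (U.inv_mem hw) _))
    exact fun k hk => this hk
  have hab : ⁅a, b⁆ ∈ K := by simpa using hX 1 U.one_mem 1 U.one_mem
  have hub : ∀ u ∈ U, ∀ v ∈ U, ⁅u, v * b⁆ ∈ K := by
    intro u hu v hv
    have e := commutatorElement_mul_left' u a (v * b)
    have h1 : ⁅a, v * b⁆ ∈ K := by simpa using hX 1 U.one_mem v hv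
    have h2 := hX u hu v hv
    rw [e] at h2
    exact (K.mul_mem_cancel_left (hconj u hu _ h1)).1 h2
  refine ⟨K, hH.of_subgroup_le ((Subgroup.closure_le _).2 ?_), ?_, hab, ?_, ?_⟩
  · rintro _ ⟨u, hu, v, hv, rfl⟩
    exact h u hu v hv
  · intro w hw
    rw [Subgroup.mem_normalizer_iff]
    refine fun k => ⟨hconj w hw k, fun hk => ?_⟩
    have := hconj w⁻¹ (U.inv_mem hw) _ hk
    simpa [mul_assoc] using this
  · intro u hu
    simpa using hub u hu 1 U.one_mem
  · rw [Subgroup.commutator_le]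
    intro u hu v hv
    have h1 : ⁅u, b⁆ ∈ K := by simpa using hub u hu 1 U.one_mem
    have h2 := hub u hu v hv
    rw [commutatorElement_mul_right'] at h2
    exact (K.mul_mem_cancel_right (hconj v hv _ h1)).1 h2

end Sections

/-! ### Baire category and the filtration of an open subgroup. -/

section Profinite

variable {G : Type*} [Group G] [TopologicalSpace G] [IsTopologicalGroup G]

theorem continuous_commutatorElement : Continuous fun p : G × G => ⁅p.1, p.2⁆ := by
  simp only [commutatorElement_def]
  fun_prop

theorem commutator_topologicalClosure_le (A B : Subgroup G) :
    ⁅A.topologicalClosure, B.topologicalClosure⁆ ≤ ⁅A, B⁆.topologicalClosure := by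
  rw [Subgroup.commutator_le]
  intro a ha b hb
  exact map_mem_closure₂ (f := fun x y : G => ⁅x, y⁆) continuous_commutatorElement ha hb
    fun x hx y hy => Subgroup.commutator_mem_commutator hx hy

theorem lowerCentralSeries_topologicalClosure_le (A : Subgroup G) (n : ℕ) :
    A.topologicalClosure.lowerCentralSeries n ≤ (A.lowerCentralSeries n).topologicalClosure := by
  induction n with
  | zero => exact le_rfl
  | succ n ih =>
    exact (Subgroup.commutator_mono ih le_rfl).trans (commutator_topologicalClosure_le _ _)

/-- The closure of a nilpotent subgroup is nilpotent. -/
theorem Group.IsNilpotent.topologicalClosure [T1Space G] {A : Subgroup G}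
    (hA : Group.IsNilpotent A) : Group.IsNilpotent A.topologicalClosure := by
  rw [Subgroup.isNilpotent_iff_lowerCentralSeries] at *
  obtain ⟨n, hn⟩ := hA
  refine ⟨n, le_bot_iff.1 ((lowerCentralSeries_topologicalClosure_le A n).trans ?_)⟩
  rw [hn]
  exact Subgroup.topologicalClosure_minimal _ le_rfl (by simp)

theorem isClosed_iteratedCentralizer (D : Subgroup G) {N : Set G} (hN : IsClosed N) (j : ℕ) :
    IsClosed (iteratedCentralizer D N j) := by
  induction j with
  | zero => exact hN
  | succ j ih =>
    have : iteratedCentralizer D N (j + 1) =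
        ⋂ d ∈ D, (fun x => ⁅x, d⁆) ⁻¹' iteratedCentralizer D N j := by
      ext x; simp [iteratedCentralizer]
    rw [this]
    exact isClosed_biInter fun d _ => ih.preimage
      (continuous_commutatorElement.comp (by fun_prop : Continuous fun x : G => (x, d)))

/-- Each condition on `d` is closed. This passes from the abstract derived subgroup to
`closedDerived G`. -/
theorem iteratedCentralizer_topologicalClosure (D : Subgroup G) {N : Set G} (hN : IsClosed N)
    (j : ℕ) : iteratedCentralizer D.topologicalClosure N j = iteratedCentralizer D N j := by
  induction j with
  | zero => rfl
  | succ j ih =>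
    ext x
    change (∀ d ∈ D.topologicalClosure, _) ↔ (∀ d ∈ D, _)
    rw [ih]
    refine ⟨fun h d hd => h d (D.le_topologicalClosure hd), fun h d hd => ?_⟩
    have hc : IsClosed ((fun d => ⁅x, d⁆) ⁻¹' iteratedCentralizer D N j) :=
      (isClosed_iteratedCentralizer D hN j).preimage
        (continuous_commutatorElement.comp (by fun_prop : Continuous fun d : G => (x, d)))
    exact closure_minimal (s := (D : Set G)) h hc hd

theorem mem_upperCentralSeries_of_mem_iteratedCentralizer {G : Type*} [Group G] (K : Subgroup G)
    (j : ℕ) (x : K) (hx : (x : G) ∈ iteratedCentralizer K {1} j) :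
    x ∈ Subgroup.upperCentralSeries K j := by
  induction j generalizing x with
  | zero => exact Subtype.ext hx
  | succ j ih => exact fun y => ih _ (hx y y.2)

variable [CompactSpace G] [TotallyDisconnectedSpace G]

/-- The pairs with commutator in `H i` form closed sets covering `G × G`. By Baire their interiors
have dense union, which meets `Ta × Tb`. -/
theorem exists_openNormalSubgroup_coset_commutators [T2Space G] {H : ℕ → Subgroup G}
    (hH : ∀ i, IsClosed (H i : Set G)) (hcov : commutatorSet G ⊆ ⋃ i, (H i : Set G))
    (T : OpenNormalSubgroup G) (a b : G) :
    ∃ t ∈ T, ∃ s ∈ T, ∃ U : OpenNormalSubgroup G, ∃ i,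
      ∀ u ∈ U, ∀ v ∈ U, ⁅u * (t * a), v * (s * b)⁆ ∈ H i := by
  let C : ℕ → Set (G × G) := fun i => (fun p => ⁅p.1, p.2⁆) ⁻¹' (H i : Set G)
  have hC : ∀ i, IsClosed (C i) := fun i => (hH i).preimage continuous_commutatorElement
  have hCU : ⋃ i, C i = Set.univ := by
    rw [Set.eq_univ_iff_forall]
    rintro ⟨x, y⟩
    obtain ⟨i, hi⟩ := Set.mem_iUnion.1 (hcov ⟨x, y, rfl⟩)
    exact Set.mem_iUnion.2 ⟨i, hi⟩
  have hd := dense_iUnion_interior_of_closed hC hCU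
  let O : Set (G × G) := (fun p => (p.1 * a⁻¹, p.2 * b⁻¹)) ⁻¹' ((T : Set G) ×ˢ (T : Set G))
  have hO : IsOpen O := (T.isOpen'.prod T.isOpen').preimage (by fun_prop)
  obtain ⟨⟨x, y⟩, ⟨hx, hy⟩, hxy⟩ := hd.inter_open_nonempty O hO
    ⟨(a, b), by simp [O]⟩
  obtain ⟨i, hi⟩ := Set.mem_iUnion.1 hxy
  have hW : (fun p : G × G => (p.1 * x, p.2 * y)) ⁻¹' interior (C i) ∈ nhds ((1, 1) : G × G) :=
    (isOpen_interior.preimage (by fun_prop)).mem_nhds (by simpa using hi)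
  rw [nhds_prod_eq] at hW
  obtain ⟨W, hW1, hW2⟩ := Filter.mem_prod_same_iff.1 hW
  obtain ⟨W', hW', hWo, hW1'⟩ := mem_nhds_iff.1 hW1
  obtain ⟨U, hU⟩ := ProfiniteGrp.exist_openNormalSubgroup_sub_open_nhds_of_one hWo hW1'
  refine ⟨x * a⁻¹, hx, y * b⁻¹, hy, U, i, fun u hu v hv => ?_⟩
  rw [inv_mul_cancel_right, inv_mul_cancel_right]
  have hmem : (u * x, v * y) ∈ C i :=
    interior_subset (hW2 (Set.mk_mem_prod (hW' (hU hu)) (hW' (hU hv))))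
  exact hmem

theorem exists_openNormalSubgroup_uniform [T2Space G] {H : ℕ → Subgroup G}
    (hH : ∀ i, IsClosed (H i : Set G)) (hcov : commutatorSet G ⊆ ⋃ i, (H i : Set G))
    (T : OpenNormalSubgroup G) :
    ∃ U : OpenNormalSubgroup G, U.toSubgroup ≤ T.toSubgroup ∧ ∀ a b : G, ∃ t ∈ T, ∃ s ∈ T, ∃ i,
      ∀ u ∈ U, ∀ v ∈ U, ⁅u * (t * a), v * (s * b)⁆ ∈ H i := by
  let Q := G ⧸ T.toSubgroup
  choose t ht s hs V i h using fun p : Q × Q =>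
    exists_openNormalSubgroup_coset_commutators hH hcov T p.1.out p.2.out
  have : Finite Q := Subgroup.quotient_finite_of_isOpen _ T.isOpen'
  let U : OpenNormalSubgroup G :=
    { toSubgroup := T.toSubgroup ⊓ ⨅ p, (V p).toSubgroup
      isOpen' := by
        change IsOpen ((T.toSubgroup ⊓ ⨅ p, (V p).toSubgroup : Subgroup G) : Set G)
        rw [Subgroup.coe_inf, Subgroup.coe_iInf]
        exact T.isOpen'.inter (isOpen_iInter_of_finite fun p => (V p).isOpen')
      isNormal' := by
        have : (⨅ p, (V p).toSubgroup).Normal := Subgroup.normal_iInf_normal fun p => (V p).isNormal'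
        exact Subgroup.normal_inf_normal _ _ }
  have hrep : ∀ a : G, ∀ t ∈ T, t * (a : Q).out * a⁻¹ ∈ T := by
    intro a t ht
    obtain ⟨⟨r, hr⟩, hr'⟩ := QuotientGroup.mk_out_eq_mul T.toSubgroup a
    rw [hr', mul_assoc]
    exact T.toSubgroup.mul_mem ht (T.isNormal'.conj_mem r hr a)
  refine ⟨U, inf_le_left, fun a b => ?_⟩
  let p : Q × Q := (a, b)
  refine ⟨t p * (a : Q).out * a⁻¹, hrep a _ (ht p), s p * (b : Q).out * b⁻¹, hrep b _ (hs p), i p,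
    fun u hu v hv => ?_⟩
  rw [inv_mul_cancel_right, inv_mul_cancel_right]
  exact h p u ((Subgroup.mem_iInf.1 hu.2) p) v ((Subgroup.mem_iInf.1 hv.2) p)

/-- If the commutators of a profinite group are covered by countably many closed nilpotent
subgroups, then the derived subgroup acts nilpotently on an open normal subgroup. -/
theorem exists_openNormalSubgroup_subset_iteratedCentralizer [T2Space G] {H : ℕ → Subgroup G}
    (hH : ∀ i, IsClosed (H i : Set G)) (hnil : ∀ i, Group.IsNilpotent (H i))
    (hcov : commutatorSet G ⊆ ⋃ i, (H i : Set G)) :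
    ∃ U : OpenNormalSubgroup G, ∃ m, (U : Set G) ⊆ iteratedCentralizer (commutator G) {1} m := by
  let Top : OpenNormalSubgroup G :=
    { toSubgroup := ⊤, isOpen' := isOpen_univ, isNormal' := inferInstance }
  -- `T` yields the nilpotent `R`, `U` the nilpotent subgroups containing `[U, sb]` with `s ∈ T`,
  -- and `V` those containing commutators of representatives adjusted within `U`.
  obtain ⟨T, -, hT⟩ := exists_openNormalSubgroup_uniform hH hcov Top
  obtain ⟨U, hUT, hU⟩ := exists_openNormalSubgroup_uniform hH hcov T
  obtain ⟨V, hVU, hV⟩ := exists_openNormalSubgroup_uniform hH hcov U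
  have := T.isNormal'
  have := U.isNormal'
  have := V.isNormal'
  have : T.toSubgroup.FiniteIndex := by
    have := Subgroup.quotient_finite_of_isOpen _ T.isOpen'
    exact Subgroup.finiteIndex_of_finite_quotient
  have : U.toSubgroup.FiniteIndex := by
    have := Subgroup.quotient_finite_of_isOpen _ U.isOpen'
    exact Subgroup.finiteIndex_of_finite_quotient
  let R : Subgroup G := ⁅T.toSubgroup, T.toSubgroup⁆
  have hR : Group.IsNilpotent R := by
    obtain ⟨t, -, s, -, i, h⟩ := hT 1 1
    obtain ⟨K, hK, -, -, -, hle⟩ := exists_isNilpotent_le_normalizer (U := T.toSubgroup) (hnil i) h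
    exact hK.of_subgroup_le hle
  obtain ⟨n, hn⟩ := (Subgroup.isNilpotent_iff_lowerCentralSeries R).1 hR
  have hsec : ∀ M N : Subgroup G, M.Normal → N.Normal → M ≤ V.toSubgroup → ⁅M, M⁆ ≤ N →
      ⁅R, M⁆ ≤ N → ∃ m, (M : Set G) ⊆ iteratedCentralizer (commutator G) N m := by
    intro M N _ _ hMV hM hRM
    refine exists_subset_iteratedCentralizer hUT hM hRM (fun b => ?_) fun a b => ?_
    · obtain ⟨t, -, s, hs, i, h⟩ := hU 1 b
      obtain ⟨K, hK, hUK, -, hub, -⟩ :=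
        exists_isNilpotent_le_normalizer (U := U.toSubgroup) (hnil i) h
      exact ⟨s, hs, K, hK, (hMV.trans hVU).trans hUK, hub⟩
    · obtain ⟨t, ht, s, hs, i, h⟩ := hV a b
      obtain ⟨K, hK, hUK, hab, -, -⟩ :=
        exists_isNilpotent_le_normalizer (U := V.toSubgroup) (hnil i) h
      exact ⟨t, ht, s, hs, K, hK, hMV.trans hUK, hab⟩
  have hVcomm : ∀ A : Subgroup G, ⁅A, V.toSubgroup⁆ ≤ V.toSubgroup := fun A =>
    Subgroup.commutator_le_right A V.toSubgroup
  -- Each section `V ∩ γ_j(R)` modulo `V ∩ γ_{j+1}(R)` is abelian and centralized by `R`, so `hsec`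
  -- applies; the lengths add up.
  have key : ∀ j, ∃ m, (V : Set G) ⊆ iteratedCentralizer (commutator G)
      (V.toSubgroup ⊓ R.lowerCentralSeries j : Subgroup G) m := by
    intro j
    induction j with
    | zero =>
      refine hsec V.toSubgroup _ inferInstance inferInstance le_rfl ?_ ?_
      · exact le_inf (hVcomm _) (Subgroup.commutator_mono (hVU.trans hUT) (hVU.trans hUT))
      · exact le_inf (hVcomm _) (Subgroup.commutator_le_left R V.toSubgroup)
    | succ j ih =>
      obtain ⟨m, hm⟩ := ih
      obtain ⟨k, hk⟩ := hsec (V.toSubgroup ⊓ R.lowerCentralSeries j)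
        (V.toSubgroup ⊓ R.lowerCentralSeries (j + 1)) inferInstance inferInstance inf_le_left
        (le_inf ((Subgroup.commutator_mono le_rfl inf_le_left).trans (hVcomm _))
          (Subgroup.commutator_mono inf_le_right
            (inf_le_right.trans (R.lowerCentralSeries_le_self j))))
        (le_inf ((Subgroup.commutator_mono le_rfl inf_le_left).trans (hVcomm _))
          ((Subgroup.commutator_comm_le _ _).trans (Subgroup.commutator_mono inf_le_right le_rfl)))
      refine ⟨k + m, ?_⟩
      rw [← iteratedCentralizer_add]
      exact hm.trans (iteratedCentralizer_mono _ hk m)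
  obtain ⟨m, hm⟩ := key n
  refine ⟨V, m, hm.trans (iteratedCentralizer_mono _ ?_ m)⟩
  rw [hn, inf_bot_eq]
  simp

theorem exists_isOpen_upperCentralSeries_of_cover [T2Space G] {H : ℕ → Subgroup G}
    (hH : ∀ i, IsClosed (H i : Set G)) (hnil : ∀ i, Group.IsNilpotent (H i))
    (hcov : commutatorSet G ⊆ ⋃ i, (H i : Set G)) :
    ∃ m : ℕ, 0 < m ∧
      IsOpen (Subgroup.upperCentralSeries (closedDerived G) m : Set (closedDerived G)) := by
  obtain ⟨U, m, hU⟩ := exists_openNormalSubgroup_subset_iteratedCentralizer hH hnil hcov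
  -- The shift only ensures that the index is positive.
  refine ⟨m + 1, m.succ_pos, ?_⟩
  have hle : U.toSubgroup.subgroupOf (closedDerived G) ≤
      Subgroup.upperCentralSeries (closedDerived G) (m + 1) := by
    refine le_trans ?_ (Subgroup.upperCentralSeries_mono _ m.le_succ)
    intro x hx
    refine mem_upperCentralSeries_of_mem_iteratedCentralizer _ m x ?_
    rw [iteratedCentralizer_topologicalClosure _ isClosed_singleton, ← commutator_eq_closure]
    exact hU hx
  exact Subgroup.isOpen_mono hle (U.isOpen'.preimage continuous_subtype_val)

end Profinite

/-! ### Baer's theorem and nilpotent subgroups containing `Z_m`. -/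

section Baer

variable {K : Type*} [Group K]

/-- The three subgroups lemma modulo a normal subgroup. -/
theorem commutator_commutator_le_of_rotate {A B C N : Subgroup K} [N.Normal]
    (h1 : ⁅⁅B, C⁆, A⁆ ≤ N) (h2 : ⁅⁅C, A⁆, B⁆ ≤ N) : ⁅⁅A, B⁆, C⁆ ≤ N := by
  have key : ∀ X : Subgroup K, X ≤ N ↔ X.map (QuotientGroup.mk' N) = ⊥ := fun X => by
    rw [Subgroup.map_eq_bot_iff, QuotientGroup.ker_mk']
  rw [key] at *
  simp only [Subgroup.map_commutator] at *
  exact Subgroup.commutator_commutator_eq_bot_of_rotate h1 h2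

theorem commutator_lowerCentralSeries_upperCentralSeries_le (i j : ℕ) :
    ⁅(⊤ : Subgroup K).lowerCentralSeries i, Subgroup.upperCentralSeries K (j + i + 1)⁆ ≤
      Subgroup.upperCentralSeries K j := by
  induction i generalizing j with
  | zero =>
    rw [Subgroup.commutator_comm]
    exact Subgroup.commutator_upperCentralSeries_top_le K j
  | succ i ih =>
    rw [Subgroup.lowerCentralSeries_succ]
    refine commutator_commutator_le_of_rotate ?_ ?_
    · rw [Subgroup.commutator_comm ⊤, Subgroup.commutator_comm]
      exact (Subgroup.commutator_mono le_rfl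
        (Subgroup.commutator_upperCentralSeries_top_le K (j + i + 1))).trans (ih j)
    · rw [Subgroup.commutator_comm _ ((⊤ : Subgroup K).lowerCentralSeries i)]
      have := ih (j + 1)
      rw [show j + 1 + i + 1 = j + (i + 1) + 1 by ring] at this
      exact (Subgroup.commutator_mono this le_rfl).trans
        (Subgroup.commutator_upperCentralSeries_top_le K j)

theorem Subgroup.finite_of_finite_map_mk {L N : Subgroup K} [N.Normal] (hN : Finite N)
    (hL : Finite (L.map (QuotientGroup.mk' N))) : Finite L := by
  have hL' : ((L.map (QuotientGroup.mk' N) : Subgroup (K ⧸ N)) : Set (K ⧸ N)).Finite := hL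
  refine (hL'.preimage' (f := QuotientGroup.mk' N) fun b _ => ?_).subset
    fun x hx => Subgroup.mem_map_of_mem _ hx
  obtain ⟨b, rfl⟩ := QuotientGroup.mk'_surjective N b
  have hN' : (N : Set K).Finite := hN
  refine (hN'.image (b * ·)).subset fun x hx => ?_
  exact ⟨b⁻¹ * x, QuotientGroup.eq.1 (Eq.symm hx), by simp⟩

/-- For abelian `M`, `[a,k]^n = a^n (k a^(-n) k⁻¹) = 1` because `a^n` is central. So `[M,K]` is a
finitely generated abelian group of finite exponent. -/
theorem finite_commutator_top_of_isMulCommutative {M : Subgroup K} [hMn : M.Normal]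
    (hM : ∀ x ∈ M, ∀ y ∈ M, x * y = y * x)
    (hX : {x | ∃ a ∈ M, ∃ k : K, ⁅a, k⁆ = x}.Finite) {n : ℕ} (hn : 0 < n)
    (hpow : ∀ a ∈ M, a ^ n ∈ Subgroup.center K) : Finite (⁅M, (⊤ : Subgroup K)⁆ : Subgroup K) := by
  have hLM : ⁅M, (⊤ : Subgroup K)⁆ ≤ M := Subgroup.commutator_le_left M ⊤
  let E : Subgroup K :=
    { carrier := {x | x ∈ M ∧ x ^ n = 1}
      one_mem' := ⟨M.one_mem, one_pow n⟩
      mul_mem' := fun {x y} hx hy => ⟨M.mul_mem hx.1 hy.1, by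
        rw [Commute.mul_pow (hM x hx.1 y hy.1), hx.2, hy.2, one_mul]⟩
      inv_mem' := fun {x} hx => ⟨M.inv_mem hx.1, by rw [inv_pow, hx.2, inv_one]⟩ }
  have hE : ⁅M, (⊤ : Subgroup K)⁆ ≤ E := by
    rw [Subgroup.commutator_le]
    intro a ha k _
    refine ⟨hLM (Subgroup.commutator_mem_commutator ha (Subgroup.mem_top k)), ?_⟩
    have h1 : ⁅a, k⁆ = a * (k * a⁻¹ * k⁻¹) := by rw [commutatorElement_def]; group
    have h2 : k * a⁻¹ * k⁻¹ ∈ M := hMn.conj_mem _ (M.inv_mem ha) k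
    rw [h1, Commute.mul_pow (hM a ha _ h2), conj_pow, inv_pow,
      Subgroup.mem_center_iff.1 (inv_mem (hpow a ha)) k]
    group
  let _ : CommGroup (⁅M, (⊤ : Subgroup K)⁆ : Subgroup K) :=
    { (inferInstance : Group (⁅M, (⊤ : Subgroup K)⁆ : Subgroup K)) with
      mul_comm := fun x y => Subtype.ext (hM x (hLM x.2) y (hLM y.2)) }
  have hfg : Group.FG (⁅M, (⊤ : Subgroup K)⁆ : Subgroup K) := by
    rw [Group.fg_iff_subgroup_fg, Subgroup.fg_iff]
    refine ⟨_, ?_, hX⟩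
    rw [Subgroup.commutator_def]
    congr 1
    ext x
    simp
  refine CommGroup.finite_of_fg_isMulTorsion _ ?_
  intro x
  rw [isOfFinOrder_iff_pow_eq_one]
  exact ⟨n, hn, Subtype.ext (hE x.2).2⟩

/-- `M` has finitely many commutators, so `[M,M]` is finite; factoring it out leaves the abelian
case. -/
theorem finite_commutator_top {M : Subgroup K} [hMn : M.Normal]
    (hX : {x | ∃ a ∈ M, ∃ k : K, ⁅a, k⁆ = x}.Finite) {n : ℕ} (hn : 0 < n)
    (hpow : ∀ a ∈ M, a ^ n ∈ Subgroup.center K) : Finite (⁅M, (⊤ : Subgroup K)⁆ : Subgroup K) := by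
  have hMM : Finite (⁅M, M⁆ : Subgroup K) := by
    have : Finite (commutatorSet M) := by
      refine Set.Finite.of_finite_image (f := M.subtype) (hX.subset ?_)
        Subtype.val_injective.injOn
      rintro _ ⟨_, ⟨a, b, rfl⟩, rfl⟩
      exact ⟨a, a.2, b, rfl⟩
    have hc : Finite (commutator M) := inferInstance
    have : (commutator M).map M.subtype = ⁅M, M⁆ := by
      rw [commutator_def, Subgroup.map_commutator, ← MonoidHom.range_eq_map, Subgroup.range_subtype]
    rw [← this]
    exact Set.Finite.image _ hc
  refine Subgroup.finite_of_finite_map_mk hMM ?_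
  set π := QuotientGroup.mk' ⁅M, M⁆ with hπ
  have hs : Function.Surjective π := QuotientGroup.mk'_surjective _
  have : (M.map π).Normal := hMn.map π hs
  rw [Subgroup.map_commutator, Subgroup.map_top_of_surjective π hs]
  refine finite_commutator_top_of_isMulCommutative ?_ ?_ hn ?_
  · rintro _ ⟨x, hx, rfl⟩ _ ⟨y, hy, rfl⟩
    rw [← commutatorElement_eq_one_iff_mul_comm, ← map_commutatorElement]
    exact (QuotientGroup.eq_one_iff _).2 (Subgroup.commutator_mem_commutator hx hy)
  · refine (hX.image π).subset ?_
    rintro _ ⟨_, ⟨a, ha, rfl⟩, k, rfl⟩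
    obtain ⟨k, rfl⟩ := hs k
    exact ⟨⁅a, k⁆, ⟨a, ha, k, rfl⟩, map_commutatorElement π a k⟩
  · rintro _ ⟨a, ha, rfl⟩
    rw [← map_pow, Subgroup.mem_center_iff]
    intro k
    obtain ⟨k, rfl⟩ := hs k
    rw [← map_mul, ← map_mul, Subgroup.mem_center_iff.1 (hpow a ha) k]

/-- **Baer's theorem**: if a term of the upper central series has finite index, then the
corresponding term of the lower central series is finite. -/
theorem finite_lowerCentralSeries_of_finiteIndex {K : Type*} [Group K] (m : ℕ)
    (h : (Subgroup.upperCentralSeries K m).FiniteIndex) :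
    Finite ((⊤ : Subgroup K).lowerCentralSeries m) := by
  induction m generalizing K with
  | zero =>
    have : (⊥ : Subgroup K).FiniteIndex := h
    have : Finite K := Finite.of_equiv _ (QuotientGroup.quotientBot (G := K)).toEquiv
    infer_instance
  | succ m ih =>
    let Z := Subgroup.center K
    let π := QuotientGroup.mk' Z
    have hs : Function.Surjective π := QuotientGroup.mk'_surjective _
    let M := (⊤ : Subgroup K).lowerCentralSeries m
    have hfin : Finite (M.map π) := by
      rw [Subgroup.map_lowerCentralSeries, Subgroup.map_top_of_surjective π hs]
      refine ih ⟨?_⟩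
      have := h.index_ne_zero
      rwa [← Subgroup.comap_upperCentralSeries_quotient_center,
        Subgroup.index_comap_of_surjective _ (QuotientGroup.mk'_surjective _)] at this
    -- Thus `[a,k]` depends only on `a` modulo the centre and `k` modulo `Z_{m+1}`, which leaves
    -- finitely many values.
    have hcomm : ∀ a ∈ M, ∀ w ∈ Subgroup.upperCentralSeries K (m + 1), ⁅a, w⁆ = 1 := by
      intro a ha w hw
      have := commutator_lowerCentralSeries_upperCentralSeries_le (K := K) m 0
      rw [zero_add] at this
      exact this (Subgroup.commutator_mem_commutator ha hw)
    rw [Subgroup.lowerCentralSeries_succ]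
    refine finite_commutator_top (n := Nat.card (M.map π)) ?_ Nat.card_pos ?_
    · have hsec : ∀ x : M.map π, ∃ a ∈ M, π a = x := fun x => x.2
      choose f hf hf' using hsec
      let F : (M.map π) × (K ⧸ Subgroup.upperCentralSeries K (m + 1)) → K :=
        fun p => ⁅f p.1, p.2.out⁆
      refine (Set.finite_range F).subset ?_
      rintro _ ⟨a, ha, k, rfl⟩
      let x : M.map π := ⟨π a, Subgroup.mem_map_of_mem π ha⟩
      refine ⟨(x, k), ?_⟩
      have hz : a⁻¹ * f x ∈ Subgroup.center K := QuotientGroup.eq.1 (hf' x).symm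
      obtain ⟨⟨w, hw⟩, hw'⟩ := QuotientGroup.mk_out_eq_mul (Subgroup.upperCentralSeries K (m + 1)) k
      have e1 : f x = (a⁻¹ * f x) * a := by
        rw [← Subgroup.mem_center_iff.1 hz a]; group
      have e2 : ∀ z ∈ Subgroup.center K, ∀ g : K, ⁅z * a, g⁆ = ⁅a, g⁆ := by
        intro z hz g
        have h1 : ⁅z, g⁆ = 1 :=
          commutatorElement_eq_one_iff_mul_comm.2 (Subgroup.mem_center_iff.1 hz g).symm
        rw [commutatorElement_mul_left', h1, mul_one, ← Subgroup.mem_center_iff.1 hz,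
          mul_inv_cancel_right]
      change ⁅f x, (k : K ⧸ Subgroup.upperCentralSeries K (m + 1)).out⁆ = ⁅a, k⁆
      rw [hw', e1, e2 _ hz, commutatorElement_mul_right', hcomm a ha w hw]
      simp
    · intro a ha
      have := congrArg Subtype.val
        (pow_card_eq_one' (x := (⟨π a, Subgroup.mem_map_of_mem π ha⟩ : M.map π)))
      have h1 : π (a ^ Nat.card (M.map π)) = 1 := by rw [map_pow]; exact this
      exact (QuotientGroup.eq_one_iff _).1 h1

theorem isFiniteByNilpotent_of_finiteIndex_upperCentralSeries (m : ℕ)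
    (h : (Subgroup.upperCentralSeries K m).FiniteIndex) : IsFiniteByNilpotent K := by
  refine ⟨(⊤ : Subgroup K).lowerCentralSeries m, inferInstance,
    finite_lowerCentralSeries_of_finiteIndex m h, ?_⟩
  rw [Subgroup.nilpotent_iff_lowerCentralSeries]
  refine ⟨m, ?_⟩
  have hs := QuotientGroup.mk'_surjective ((⊤ : Subgroup K).lowerCentralSeries m)
  rw [← Subgroup.map_top_of_surjective _ hs, ← Subgroup.map_lowerCentralSeries,
    Subgroup.map_eq_bot_iff, QuotientGroup.ker_mk']

/-- Modulo `Z_m` the subgroup is cyclic, so its commutators lie in `Z_m`, and `m` further steps kill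
them. -/
theorem isNilpotent_zpowers_sup_upperCentralSeries (k : K) (m : ℕ) :
    Group.IsNilpotent (Subgroup.zpowers k ⊔ Subgroup.upperCentralSeries K m : Subgroup K) := by
  set P : Subgroup K := Subgroup.zpowers k ⊔ Subgroup.upperCentralSeries K m with hP
  have h1 : ∀ j, ∀ x : P, (x : K) ∈ Subgroup.upperCentralSeries K j →
      x ∈ Subgroup.upperCentralSeries P j := by
    intro j
    induction j with
    | zero => exact fun x hx => Subtype.ext hx
    | succ j ih => exact fun x hx y => ih _ (hx y)
  refine ⟨m + 1, eq_top_iff.2 fun x _ y => h1 m _ ?_⟩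
  have hπ : ∀ x ∈ P, QuotientGroup.mk' (Subgroup.upperCentralSeries K m) x ∈
      Subgroup.zpowers (QuotientGroup.mk' (Subgroup.upperCentralSeries K m) k) := by
    intro x hx
    have := Subgroup.mem_map_of_mem (QuotientGroup.mk' (Subgroup.upperCentralSeries K m)) hx
    rwa [hP, Subgroup.map_sup, QuotientGroup.map_mk'_self, sup_bot_eq, MonoidHom.map_zpowers]
      at this
  refine (QuotientGroup.eq_one_iff _).1 ?_
  change QuotientGroup.mk' (Subgroup.upperCentralSeries K m) ⁅(x : K), (y : K)⁆ = 1
  rw [map_commutatorElement, commutatorElement_eq_one_iff_mul_comm]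
  obtain ⟨i, hi⟩ := hπ x x.2
  obtain ⟨j, hj⟩ := hπ y y.2
  rw [← hi, ← hj]
  exact (Commute.refl _).zpow_zpow i j

end Baer

/-! ### Open upper central terms from finite-by-nilpotency; closed covers from open terms. -/

section FiniteByNilpotent

/-- An open normal `U` avoids the nontrivial elements of `N`. Iterated commutators starting in `U`
stay in `U`, so once they reach `N` they are trivial. -/
theorem exists_isOpen_upperCentralSeries_of_isFiniteByNilpotent {K : Type*} [Group K]
    [TopologicalSpace K] [IsTopologicalGroup K] [CompactSpace K] [TotallyDisconnectedSpace K]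
    (h : IsFiniteByNilpotent K) :
    ∃ m : ℕ, 0 < m ∧ IsOpen (Subgroup.upperCentralSeries K m : Set K) := by
  obtain ⟨N, hN, hfin, ⟨c, hc⟩⟩ := h
  have hfin' : (N : Set K).Finite := hfin
  obtain ⟨U, hU⟩ := ProfiniteGrp.exist_openNormalSubgroup_sub_open_nhds_of_one
    (hfin'.subset Set.sdiff_subset : ((N : Set K) \ {1}).Finite).isClosed.isOpen_compl (by simp)
  have hUn := U.isNormal'
  have key : ∀ j, ∀ x ∈ U, QuotientGroup.mk' N x ∈ Subgroup.upperCentralSeries (K ⧸ N) j →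
      x ∈ Subgroup.upperCentralSeries K j := by
    intro j
    induction j with
    | zero =>
      intro x hx hx'
      by_contra hne
      exact hU hx ⟨(QuotientGroup.eq_one_iff x).1 hx', hne⟩
    | succ j ih =>
      intro x hx hx' y
      refine ih _ ?_ (by rw [map_commutatorElement]; exact hx' _)
      exact Subgroup.commutator_le_left U.toSubgroup ⊤
        (Subgroup.commutator_mem_commutator hx (Subgroup.mem_top y))
  refine ⟨c + 1, c.succ_pos, ?_⟩
  have hle : U.toSubgroup ≤ Subgroup.upperCentralSeries K (c + 1) := fun x hx =>
    Subgroup.upperCentralSeries_mono K c.le_succ (key c x hx (hc ▸ Subgroup.mem_top _))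
  exact Subgroup.isOpen_mono hle U.isOpen'

theorem exists_closed_nilpotent_cover {G : Type*} [Group G] [TopologicalSpace G]
    [IsTopologicalGroup G] [CompactSpace G] {m : ℕ}
    (h : IsOpen (Subgroup.upperCentralSeries (closedDerived G) m : Set (closedDerived G))) :
    ∃ H : ℕ → Subgroup G,
      (∀ i, IsClosed (H i : Set G) ∧ Group.IsNilpotent (H i)) ∧
        commutatorSet G ⊆ ⋃ i, (H i : Set G) := by
  have hcl : IsClosed (closedDerived G : Set G) := Subgroup.isClosed_topologicalClosure _
  have : CompactSpace (closedDerived G) := isCompact_iff_compactSpace.1 hcl.isCompact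
  have : Finite (closedDerived G ⧸ Subgroup.upperCentralSeries (closedDerived G) m) :=
    Subgroup.quotient_finite_of_isOpen _ h
  obtain ⟨q, hq⟩ :=
    exists_surjective_nat (closedDerived G ⧸ Subgroup.upperCentralSeries (closedDerived G) m)
  let P : ℕ → Subgroup (closedDerived G) := fun i =>
    Subgroup.zpowers (q i).out ⊔ Subgroup.upperCentralSeries (closedDerived G) m
  refine ⟨fun i => (P i).map (closedDerived G).subtype, fun i => ⟨?_, ?_⟩, ?_⟩
  · have hP : IsClosed (P i : Set (closedDerived G)) :=
      Subgroup.isClosed_of_isOpen _ (Subgroup.isOpen_mono le_sup_right h)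
    exact hcl.isClosedEmbedding_subtypeVal.isClosedMap _ hP
  · exact (isNilpotent_zpowers_sup_upperCentralSeries _ m).map_subgroup _
  · intro x hx
    let y : closedDerived G :=
      ⟨x, Subgroup.le_topologicalClosure _ (Subgroup.subset_closure hx)⟩
    obtain ⟨i, hi⟩ := hq y
    refine Set.mem_iUnion.2 ⟨i, y, ?_, rfl⟩
    have h1 : (q i).out⁻¹ * y ∈ Subgroup.upperCentralSeries (closedDerived G) m :=
      QuotientGroup.eq.1 (by rw [QuotientGroup.out_eq', hi])
    have h2 := (P i).mul_mem (Subgroup.mem_sup_left (Subgroup.mem_zpowers (q i).out))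
      (Subgroup.mem_sup_right h1)
    rwa [mul_inv_cancel_left] at h2

end FiniteByNilpotent

theorem theorem1p3 {G : Type*} [Group G] [TopologicalSpace G] [IsTopologicalGroup G]
    [CompactSpace G] [TotallyDisconnectedSpace G] :
    List.TFAE [
      ∃ H : ℕ → Subgroup G,
        (∀ i, Group.IsNilpotent (H i)) ∧ commutatorSet G ⊆ ⋃ i, (H i : Set G),
      ∃ H : ℕ → Subgroup G,
        (∀ i, IsClosed (H i : Set G) ∧ Group.IsNilpotent (H i)) ∧
          commutatorSet G ⊆ ⋃ i, (H i : Set G),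
      IsFiniteByNilpotent (closedDerived G),
      ∃ m : ℕ, 0 < m ∧
        IsOpen (Subgroup.upperCentralSeries (closedDerived G) m : Set (closedDerived G))] := by
  have hcl : IsClosed (closedDerived G : Set G) := Subgroup.isClosed_topologicalClosure _
  have : CompactSpace (closedDerived G) := isCompact_iff_compactSpace.1 hcl.isCompact
  have : T2Space G := inferInstance
  tfae_have 1 → 4 := by
    rintro ⟨H, hnil, hcov⟩
    exact exists_isOpen_upperCentralSeries_of_cover
      (fun i => (H i).isClosed_topologicalClosure) (fun i => (hnil i).topologicalClosure)
      (hcov.trans (Set.iUnion_mono fun i => (H i).le_topologicalClosure))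
  tfae_have 4 → 2 := fun ⟨m, _, h⟩ => exists_closed_nilpotent_cover h
  tfae_have 2 → 1 := fun ⟨H, h, hcov⟩ => ⟨H, fun i => (h i).2, hcov⟩
  tfae_have 3 → 4 := exists_isOpen_upperCentralSeries_of_isFiniteByNilpotent
  tfae_have 4 → 3 := by
    rintro ⟨m, -, h⟩
    have := Subgroup.quotient_finite_of_isOpen _ h
    exact isFiniteByNilpotent_of_finiteIndex_upperCentralSeries m
      Subgroup.finiteIndex_of_finite_quotient
  tfae_finish
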